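/- There is an absolute constant $c>0$ such that the following holds. Let $\xi$ be a real sub-Gaussian random variable (i.e. $\mathbb{P}[|\xi|>t]\le Ce^{-at^2}$ for all $t\ge 0$, for some constants $a,C>0$) having a density with respect to Lebesgue measure bounded by $K$. Let $n$ be a nonnegative integer and let $G_n$ be an $n\times n$ random matrix such that the entries of $n^{1/2}G_n$ are independent copies of $\xi$. Let $\|\cdot\|$ denote the $\ell^2\to\ell^2$ operator norm, and for $M\in\mathbb{R}^{n\times n}$ with complex eigenvalues $\lambda_1,\dots,\lambda_n$, listed with algebraic multiplicity, let $\eta(M)=\min_{i\ne j}|\lambda_i-\lambda_j|$ (with $\eta(M)=+\infty$ if $n\le 1$). Let $A\in\mathbb{R}^{n\times n}$ be any deterministic matrix with $\|A\|\le 1$, let $\delta\in(0,1)$, let $M=A+\delta G_n$, let $K'\ge 0$ and let $0<s\le 1$. Then \[\mathbb{P}\big[\|G_n\|\le K'\ \text{and}\ \eta(M)\le s\big]\le c\,\log_2\!\left(\frac{2(1+\delta K')}{s}\right)(1+\delta K')^2\max(K^2,K^3)\,n^5\,\frac{s}{\delta^3}.\] -/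

import Mathlib

open MeasureTheory ProbabilityTheory

noncomputable section

namespace EigenvalueGap

/-- The `ℓ² → ℓ²` operator norm of a real square matrix. -/
def opNorm {n : ℕ} (A : Matrix (Fin n) (Fin n) ℝ) : ℝ :=
  ‖Matrix.toEuclideanCLM (𝕜 := ℝ) A‖

/-- The complex eigenvalues of a real square matrix, with algebraic multiplicity. -/
def eigenvalues {n : ℕ} (M : Matrix (Fin n) (Fin n) ℝ) : Multiset ℂ :=
  (M.map (algebraMap ℝ ℂ)).charpoly.roots

/-- The minimum eigenvalue gap `η(M) = min_{i ≠ j} |λᵢ - λⱼ|`, where `λ₁, …, λₙ` are the complex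
eigenvalues listed with multiplicity: `{z, w} ≤ eigenvalues M` says that `z` and `w` occur at two
different places of this list. So `η(M) = 0` if there is a multiple eigenvalue, and `η(M) = ∞`
(the infimum over no pairs) if `n ≤ 1`. -/
def gap {n : ℕ} (M : Matrix (Fin n) (Fin n) ℝ) : ENNReal :=
  ⨅ (z : ℂ) (w : ℂ) (_ : ({z, w} : Multiset ℂ) ≤ eigenvalues M), ‖z - w‖ₑ

/-- A real random variable is sub-Gaussian if `ℙ[|ξ| > t] ≤ C exp(-a t²)` for all `t ≥ 0`, for some
constants `a, C > 0`. (No centering is required.) -/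
def IsSubGaussian {Ω : Type*} [MeasurableSpace Ω] (ξ : Ω → ℝ) (P : Measure Ω) : Prop :=
  ∃ a C : ℝ, 0 < a ∧ 0 < C ∧
    ∀ t : ℝ, 0 ≤ t → P.real {ω | t < |ξ ω|} ≤ C * Real.exp (-a * t ^ 2)

/-- `ξ` has a density with respect to Lebesgue measure that is bounded by `K`. -/
def HasDensityBoundedBy {Ω : Type*} [MeasurableSpace Ω] (ξ : Ω → ℝ) (P : Measure Ω) (K : ℝ) :
    Prop :=
  HasPDF ξ P volume ∧ ∀ᵐ x ∂(volume : Measure ℝ), pdf ξ P volume x ≤ ENNReal.ofReal K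

/-- `G` is a random matrix `Gₙ(ξ)`: the entries of `√n • G` are independent copies of `ξ`. -/
def IsScaledIIDMatrix {Ω Ω' : Type*} [MeasurableSpace Ω] [MeasurableSpace Ω'] {n : ℕ}
    (G : Ω → Matrix (Fin n) (Fin n) ℝ) (P : Measure Ω) (ξ : Ω' → ℝ) (P' : Measure Ω') : Prop :=
  iIndepFun (fun (p : Fin n × Fin n) ω => √(n : ℝ) * G ω p.1 p.2) P ∧
    ∀ i j, IdentDistrib (fun ω => √(n : ℝ) * G ω i j) ξ P P'

end EigenvalueGap

end

/-!
Fix `z ∈ ℂ`. If `a, b` are two eigenvalues of `M`, a Schur pair for `Mᵀ` gives an isometry `V` with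
two columns such that `Vᵀ (M - z)` is a `2 × 2` triangular matrix with diagonal `a - z, b - z`,
times `Vᵀ`. Let the columns of `H` be orthonormal and annihilated by all rows of `M - z` but `j` and
`k`. Taking determinants in `Vᵀ (M - z) H` shows that the product of the minors of `V` and of
`(M - z) H` on the rows `j, k` is at most `2 |a - z| |b - z|`. The squared minors of `V` sum to a
constant, so some pair of rows has a minor of `V` which is not small, and for this pair rows `j` and
`k` of `M - z` are nearly dependent modulo the other ones. Pigeonholing over `j, k` and dyadically
over the size `w` of the minor of `V` loses nothing: the minor of `(M - z) H` is then `O(t / w)`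
with `t = |a - z| |b - z|`, which has probability `O((t / w) ^ (3 / 2))`, and the weight `w ^ 2`
beats `w ^ (-3 / 2)`.

The power `3 / 2` comes from conditioning on all rows but `j, k`. Row `k` has a small component in
the plane of `H` with a probability quadratic in that component. Given row `k`, the minor is an
affine function `f · x + c` of row `j`. It is small with probability `O(t)`, and even `O(t ^ 2)`
when `f` is not close to a multiple of a real vector. As `f` is an approximate eigenvector of the
real matrix `M` for `z`, the latter holds quantitatively in terms of `|Im z|`, and the geometric
mean of the two bounds is `O(t ^ (3 / 2) |Im z| ^ (-1 / 2))`.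

Two eigenvalues at distance `s` lie at distance `O(s)` from a point `z` of a grid of mesh `s` which
avoids the real axis, so that `t = O(s ^ 2)`. The `O(s⁻²)` grid points contribute `O(s ^ 3)` each,
up to the factor `|Im z| ^ (-1 / 2)`, whose singularity is summable. Hence the bound is linear in
`s`, without the logarithm.
-/

noncomputable section

namespace EigenvalueGap

section SmallBall

lemma lintegral_pi_update {ι : Type*} [Fintype ι] [DecidableEq ι] {X : ι → Type*}
    [∀ i, MeasurableSpace (X i)] (μ : ∀ i, Measure (X i)) [∀ i, IsProbabilityMeasure (μ i)]
    (i : ι) {f : (∀ i, X i) → ENNReal} (hf : Measurable f) :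
    ∫⁻ x, f x ∂Measure.pi μ = ∫⁻ x, ∫⁻ u, f (Function.update x i u) ∂μ i ∂Measure.pi μ := by
  have hmarginal : lmarginal μ {i} f = lmarginal μ {i} (lmarginal μ {i} f) := by
    ext x
    rw [lmarginal_singleton (lmarginal μ {i} f)]
    simp [lmarginal_update_of_mem μ (Finset.mem_singleton_self i)]
  rw [lintegral_eq_of_lmarginal_eq {i} hf (hf.lmarginal μ) hmarginal, lmarginal_singleton]

lemma pi_inter_le_mul {ι : Type*} [Fintype ι] [DecidableEq ι] {X : ι → Type*}
    [∀ i, MeasurableSpace (X i)] (μ : ∀ i, Measure (X i)) [∀ i, IsProbabilityMeasure (μ i)]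
    (i : ι) {S T : Set (∀ i, X i)} (hS : MeasurableSet S) (hT : MeasurableSet T)
    (hSi : ∀ x u, Function.update x i u ∈ S ↔ x ∈ S) {a : ENNReal}
    (hTi : ∀ x ∈ S, μ i {u | Function.update x i u ∈ T} ≤ a) :
    Measure.pi μ (T ∩ S) ≤ a * Measure.pi μ S := by
  rw [← lintegral_indicator_one (hT.inter hS), ← lintegral_indicator_one hS,
    lintegral_pi_update μ i (measurable_one.indicator (hT.inter hS)),
    ← lintegral_const_mul _ (measurable_one.indicator hS)]
  refine lintegral_mono fun x => ?_
  have hsection : ∀ u, (T ∩ S).indicator (1 : (∀ i, X i) → ENNReal) (Function.update x i u)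
      = S.indicator 1 x * {u | Function.update x i u ∈ T}.indicator 1 u := fun u => by
    rw [Set.inter_indicator_one, Pi.mul_apply, mul_comm,
      Set.indicator_eq_indicator (g := 1) (hSi x u) rfl]
    rfl
  have hTx : MeasurableSet {u | Function.update x i u ∈ T} := measurable_update x hT
  simp only [hsection]
  rw [lintegral_const_mul _ (measurable_one.indicator hTx), lintegral_indicator_one hTx, mul_comm]
  by_cases hx : x ∈ S
  · simpa [hx] using hTi x hx
  · simp [hx]

lemma measure_norm_mul_add_le {ν : Measure ℝ} {κ : ℝ} (hν : ν ≤ ENNReal.ofReal κ • volume)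
    {α : ℂ} (hα : α ≠ 0) (β : ℂ) {r : ℝ} (hr : 0 ≤ r) :
    ν {u : ℝ | ‖α * u + β‖ ≤ r} ≤ ENNReal.ofReal (2 * κ * r / ‖α‖) := by
  have hpos : 0 < ‖α‖ := norm_pos_iff.mpr hα
  have hsub : {u : ℝ | ‖α * u + β‖ ≤ r} ⊆ Metric.closedBall (-(β / α).re) (r / ‖α‖) := by
    intro u hu
    have hfactor : ‖(u : ℂ) + β / α‖ * ‖α‖ = ‖α * u + β‖ := by
      rw [← norm_mul]; congr 1; field_simp
    rw [Metric.mem_closedBall, Real.dist_eq, sub_neg_eq_add, le_div_iff₀ hpos]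
    calc |u + (β / α).re| * ‖α‖ ≤ ‖(u : ℂ) + β / α‖ * ‖α‖ := by
          gcongr; simpa using Complex.abs_re_le_norm ((u : ℂ) + β / α)
      _ ≤ r := hfactor.trans_le hu
  calc ν {u : ℝ | ‖α * u + β‖ ≤ r}
      ≤ (ENNReal.ofReal κ • volume) (Metric.closedBall (-(β / α).re) (r / ‖α‖)) :=
        (hν _).trans (measure_mono hsub)
    _ = ENNReal.ofReal (2 * κ * r / ‖α‖) := by
        rw [Measure.smul_apply, Real.volume_closedBall, smul_eq_mul,
          ← ENNReal.ofReal_mul' (by positivity)]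
        ring_nf

variable {ι : Type*} [Fintype ι]

lemma measurableSet_norm_affine_le (f : ι → ℂ) (w : ℂ) (r : ℝ) :
    MeasurableSet {x : ι → ℝ | ‖∑ i, f i * (x i : ℂ) + w‖ ≤ r} :=
  measurableSet_le (by fun_prop) measurable_const

lemma exists_le_norm_apply {f : ι → ℂ} {ρ : ℝ} (hρ : 0 < ρ) (hf : ρ ^ 2 ≤ ∑ i, ‖f i‖ ^ 2) :
    ∃ c, ρ / √(Fintype.card ι) ≤ ‖f c‖ := by
  by_contra! hlt
  have hne : Nonempty ι := not_isEmpty_iff.mp fun _ => by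
    rw [Finset.univ_eq_empty, Finset.sum_empty] at hf
    exact (pow_pos hρ 2).not_ge hf
  have hcard : (0 : ℝ) < Fintype.card ι := by exact_mod_cast Fintype.card_pos
  have hsq : ∀ i, ‖f i‖ ^ 2 < ρ ^ 2 / Fintype.card ι := fun i => by
    rw [← Real.sq_sqrt hcard.le, ← div_pow]
    exact pow_lt_pow_left₀ (hlt i) (norm_nonneg _) two_ne_zero
  refine (hf.trans_lt (Finset.sum_lt_sum_of_nonempty Finset.univ_nonempty fun i _ => hsq i)).ne ?_
  simp [mul_div_cancel₀ _ hcard.ne']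

variable {ν : ι → Measure ℝ} [∀ i, IsProbabilityMeasure (ν i)] {κ : ℝ}

lemma pi_affine_inter_le [DecidableEq ι] (hν : ∀ i, ν i ≤ ENNReal.ofReal κ • volume)
    (f : ι → ℂ) (w : ℂ) {r : ℝ} (hr : 0 ≤ r) {c : ι} (hc : f c ≠ 0)
    {S : Set (ι → ℝ)} (hS : MeasurableSet S) (hSc : ∀ x u, Function.update x c u ∈ S ↔ x ∈ S) :
    Measure.pi ν ({x | ‖∑ i, f i * (x i : ℂ) + w‖ ≤ r} ∩ S)
      ≤ ENNReal.ofReal (2 * κ * r / ‖f c‖) * Measure.pi ν S := by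
  refine pi_inter_le_mul ν c hS (measurableSet_norm_affine_le f w r) hSc fun x _ => ?_
  have hsplit : ∀ u : ℝ, ∑ i, f i * (Function.update x c u i : ℂ) + w
      = f c * u + (∑ i ∈ Finset.univ.erase c, f i * (x i : ℂ) + w) := fun u => by
    rw [← Finset.add_sum_erase _ _ (Finset.mem_univ c), Function.update_self, add_assoc]
    congr 2
    exact Finset.sum_congr rfl fun i hi => by rw [Function.update_of_ne (Finset.ne_of_mem_erase hi)]
  simp only [Set.mem_ofPred_eq, hsplit]
  exact measure_norm_mul_add_le (hν c) hc _ hr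

lemma pi_affine_le (hν : ∀ i, ν i ≤ ENNReal.ofReal κ • volume) (f : ι → ℂ) (w : ℂ)
    {r : ℝ} (hr : 0 ≤ r) {c : ι} (hc : f c ≠ 0) :
    Measure.pi ν {x | ‖∑ i, f i * (x i : ℂ) + w‖ ≤ r} ≤ ENNReal.ofReal (2 * κ * r / ‖f c‖) := by
  classical
  simpa using pi_affine_inter_le hν f w hr hc MeasurableSet.univ (by simp)

lemma pi_affine_affine_le (hκ : 0 ≤ κ) (hν : ∀ i, ν i ≤ ENNReal.ofReal κ • volume)
    (f g : ι → ℂ) (w w' : ℂ) {r r' : ℝ} (hr : 0 ≤ r) (hr' : 0 ≤ r') {c d : ι} {m m' : ℝ}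
    (hm : 0 < m) (hm' : 0 < m') (hc : m ≤ ‖f c‖) (hd : m' ≤ ‖g d‖) (hg : g c = 0) :
    Measure.pi ν {x | ‖∑ i, f i * (x i : ℂ) + w‖ ≤ r ∧ ‖∑ i, g i * (x i : ℂ) + w'‖ ≤ r'}
      ≤ ENNReal.ofReal (2 * κ * r / m * (2 * κ * r' / m')) := by
  classical
  have hind : ∀ (x : ι → ℝ) u, ∑ i, g i * (Function.update x c u i : ℂ)
      = ∑ i, g i * (x i : ℂ) := fun x u => Finset.sum_congr rfl fun i _ => by
    rcases eq_or_ne i c with rfl | hi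
    · simp [hg]
    · rw [Function.update_of_ne hi]
  have h₁ := pi_affine_inter_le hν f w hr (norm_pos_iff.mp (hm.trans_le hc))
    (measurableSet_norm_affine_le g w' r') fun x u => by simp [hind]
  have h₂ := pi_affine_le hν g w' hr' (norm_pos_iff.mp (hm'.trans_le hd))
  rw [ENNReal.ofReal_mul (by positivity)]
  exact h₁.trans (mul_le_mul' (ENNReal.ofReal_le_ofReal (by gcongr))
    (h₂.trans (ENNReal.ofReal_le_ofReal (by gcongr))))

lemma pi_affine_le_of_norm (hκ : 0 ≤ κ) (hν : ∀ i, ν i ≤ ENNReal.ofReal κ • volume)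
    (f : ι → ℂ) (w : ℂ) {t ρ : ℝ} (ht : 0 ≤ t) (hρ : 0 < ρ) (hf : ρ ^ 2 ≤ ∑ i, ‖f i‖ ^ 2) :
    Measure.pi ν {x | ‖∑ i, f i * (x i : ℂ) + w‖ ≤ t}
      ≤ ENNReal.ofReal (2 * κ * √(Fintype.card ι) * t / ρ) := by
  obtain ⟨c, hc⟩ := exists_le_norm_apply hρ hf
  have hcard : (0 : ℝ) < Fintype.card ι := by exact_mod_cast Fintype.card_pos_iff.mpr ⟨c⟩
  have hpos : 0 < ρ / √(Fintype.card ι) := by positivity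
  refine (pi_affine_le hν f w ht (norm_pos_iff.mp (hpos.trans_le hc))).trans
    (ENNReal.ofReal_le_ofReal ?_)
  calc 2 * κ * t / ‖f c‖ ≤ 2 * κ * t / (ρ / √(Fintype.card ι)) := by gcongr
    _ = _ := by field_simp

lemma exists_norm_eq_one_mul_im_eq_zero (z : ℂ) : ∃ ω : ℂ, ‖ω‖ = 1 ∧ (ω * z).im = 0 := by
  obtain ⟨ω, hω, hz⟩ := RCLike.exists_norm_eq_mul_self z
  exact ⟨ω, hω, by rw [← hz]; exact Complex.ofReal_im _⟩

/- If no rotation of `f` is nearly real, then `f · x` is genuinely two-dimensional: after rotating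
its largest coordinate to the real axis, the imaginary part does not involve that coordinate. -/
lemma pi_affine_le_of_im (hκ : 0 ≤ κ) (hν : ∀ i, ν i ≤ ENNReal.ofReal κ • volume)
    (f : ι → ℂ) (w : ℂ) {t ρ b : ℝ} (ht : 0 ≤ t) (hρ : 0 < ρ) (hf : ρ ^ 2 ≤ ∑ i, ‖f i‖ ^ 2)
    (hb : 0 < b) (him : ∀ ω : ℂ, ‖ω‖ = 1 → b ^ 2 ≤ ∑ i, (ω * f i).im ^ 2) :
    Measure.pi ν {x | ‖∑ i, f i * (x i : ℂ) + w‖ ≤ t}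
      ≤ ENNReal.ofReal (2 * κ * √(Fintype.card ι) * t / ρ
          * (2 * κ * √(Fintype.card ι) * t / b)) := by
  obtain ⟨c, hc⟩ := exists_le_norm_apply hρ hf
  have hcard : (0 : ℝ) < Fintype.card ι := by exact_mod_cast Fintype.card_pos_iff.mpr ⟨c⟩
  obtain ⟨ω, hω, hωc⟩ := exists_norm_eq_one_mul_im_eq_zero (f c)
  obtain ⟨d, hd⟩ := exists_le_norm_apply (f := fun i => ((ω * f i).im : ℂ)) hb
    (by simpa only [Complex.norm_real, Real.norm_eq_abs, sq_abs] using him ω hω)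
  have hpair := pi_affine_affine_le hκ hν f (fun i => ((ω * f i).im : ℂ)) w ((ω * w).im : ℂ)
    ht ht (by positivity) (by positivity) hc hd (by simp [hωc])
  refine (measure_mono ?_).trans (hpair.trans_eq ?_)
  · intro x hx
    refine ⟨hx, ?_⟩
    have hrotate : ∑ i, ((ω * f i).im : ℂ) * (x i : ℂ) + ((ω * w).im : ℂ)
        = ((ω * (∑ i, f i * (x i : ℂ) + w)).im : ℂ) := by
      simp only [mul_add, Finset.mul_sum, Complex.add_im, Complex.im_sum, ← mul_assoc,
        Complex.im_mul_ofReal]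
      push_cast
      rfl
    rw [hrotate, Complex.norm_real, Real.norm_eq_abs]
    calc |(ω * (∑ i, f i * (x i : ℂ) + w)).im| ≤ ‖ω * (∑ i, f i * (x i : ℂ) + w)‖ :=
          Complex.abs_im_le_norm _
      _ ≤ t := by rwa [norm_mul, hω, one_mul]
  · congr 1; field_simp

end SmallBall

section Frame

variable {ι m : Type*} [Fintype ι] [DecidableEq m] {H : Matrix ι m ℂ}

open Matrix

lemma star_dotProduct_self (v : ι → ℂ) : star v ⬝ᵥ v = ((∑ i, ‖v i‖ ^ 2 : ℝ) : ℂ) := by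
  simp [dotProduct, Complex.conj_mul']

lemma sum_norm_sq_mulVec [Fintype m] (hH : Hᴴ * H = 1) (p : m → ℂ) :
    ∑ i, ‖(H *ᵥ p) i‖ ^ 2 = ∑ b, ‖p b‖ ^ 2 := by
  have hdot : star (H *ᵥ p) ⬝ᵥ (H *ᵥ p) = star p ⬝ᵥ p := by
    rw [star_mulVec, dotProduct_mulVec, vecMul_vecMul, hH, vecMul_one]
  rw [star_dotProduct_self, star_dotProduct_self] at hdot
  exact_mod_cast hdot

lemma sum_norm_sq_col (hH : Hᴴ * H = 1) (b : m) : ∑ i, ‖H i b‖ ^ 2 = 1 := by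
  have hdiag := star_dotProduct_self fun i => H i b
  rw [show star (fun i => H i b) ⬝ᵥ (fun i => H i b) = (Hᴴ * H) b b from rfl, hH, one_apply_eq]
    at hdiag
  exact_mod_cast hdiag.symm

lemma one_le_sum_norm_sq_col_sub [Finite m] (hH : Hᴴ * H = 1) {b b' : m} (hb : b' ≠ b) (a : ℂ) :
    1 ≤ ∑ i, ‖H i b' - a * H i b‖ ^ 2 := by
  have := Fintype.ofFinite m
  set p : m → ℂ := Pi.single b' 1 - Pi.single b a with hp
  calc (1 : ℝ) = ‖p b'‖ ^ 2 := by simp [hp, hb]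
    _ ≤ ∑ e, ‖p e‖ ^ 2 :=
        Finset.single_le_sum (f := fun e => ‖p e‖ ^ 2) (fun _ _ => by positivity)
          (Finset.mem_univ b')
    _ = ∑ i, ‖H i b' - a * H i b‖ ^ 2 := by
        rw [← sum_norm_sq_mulVec hH]
        simp [hp, mulVec_sub, mulVec_single]

lemma exists_pivot [Finite m] [Nonempty m] (hH : Hᴴ * H = 1) :
    ∃ c b, 1 / √(Fintype.card ι) ≤ ‖H c b‖ ∧ ∀ b', ‖H c b'‖ ≤ ‖H c b‖ := by
  obtain ⟨b₀⟩ := ‹Nonempty m›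
  obtain ⟨c₀, hc₀⟩ := exists_le_norm_apply one_pos
    (by rw [one_pow, sum_norm_sq_col hH b₀])
  have : Nonempty (ι × m) := ⟨(c₀, b₀)⟩
  obtain ⟨⟨c, b⟩, hmax⟩ := Finite.exists_max fun p : ι × m => ‖H p.1 p.2‖
  exact ⟨c, b, hc₀.trans (hmax (c₀, b₀)), fun b' => hmax (c, b')⟩

lemma pi_frame_le {H : Matrix ι (Fin 2) ℂ} (hH : Hᴴ * H = 1)
    {ν : ι → Measure ℝ} [∀ i, IsProbabilityMeasure (ν i)] {κ : ℝ} (hκ : 0 ≤ κ)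
    (hν : ∀ i, ν i ≤ ENNReal.ofReal κ • volume) (w : Fin 2 → ℂ) {r : ℝ} (hr : 0 ≤ r) :
    Measure.pi ν {x | ∀ b, ‖∑ i, H i b * (x i : ℂ) + w b‖ ≤ r}
      ≤ ENNReal.ofReal (8 * κ ^ 2 * Fintype.card ι * r ^ 2) := by
  obtain ⟨c, b, hc, hmax⟩ := exists_pivot hH
  obtain ⟨b', hb'⟩ := exists_ne b
  have hcard : (0 : ℝ) < Fintype.card ι := by exact_mod_cast Fintype.card_pos_iff.mpr ⟨c⟩
  have hpos : 0 < ‖H c b‖ := (by positivity : 0 < 1 / √(Fintype.card ι : ℝ)).trans_le hc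
  set a : ℂ := H c b' / H c b with ha
  have hnorm_a : ‖a‖ ≤ 1 := by
    rw [ha, norm_div]; exact div_le_one_of_le₀ (hmax b') hpos.le
  have hgc : H c b' - a * H c b = 0 := by
    rw [ha, div_mul_cancel₀ _ (norm_pos_iff.mp hpos), sub_self]
  obtain ⟨d, hd⟩ := exists_le_norm_apply one_pos
    (by simpa only [one_pow] using one_le_sum_norm_sq_col_sub hH hb' a)
  have hpair := pi_affine_affine_le hκ hν (fun i => H i b) (fun i => H i b' - a * H i b) (w b)
    (w b' - a * w b) hr (by positivity : 0 ≤ 2 * r) (by positivity) (by positivity) hc hd hgc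
  refine (measure_mono ?_).trans (hpair.trans_eq ?_)
  · intro x hx
    refine ⟨hx b, ?_⟩
    have hcomb : ∑ i, (H i b' - a * H i b) * (x i : ℂ) + (w b' - a * w b)
        = (∑ i, H i b' * (x i : ℂ) + w b') - a * (∑ i, H i b * (x i : ℂ) + w b) := by
      simp only [sub_mul, Finset.sum_sub_distrib, mul_add, Finset.mul_sum, mul_assoc]
      ring
    calc _ ≤ ‖∑ i, H i b' * (x i : ℂ) + w b'‖ + ‖a‖ * ‖∑ i, H i b * (x i : ℂ) + w b‖ := by
          rw [hcomb, ← norm_mul]; exact norm_sub_le _ _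
      _ ≤ r + 1 * r := by gcongr; exacts [hx b', hx b]
      _ = 2 * r := by ring
  · congr 1
    field_simp
    rw [Real.sq_sqrt hcard.le]; ring

end Frame

section Moment

variable {Ω : Type*} [MeasurableSpace Ω] (μ : Measure Ω) [IsProbabilityMeasure μ]

lemma lintegral_Ioi_const_mul_rpow_neg {a B p : ℝ} (ha : 0 < a) (hB : 0 ≤ B) (hp : 1 < p) :
    ∫⁻ t in Set.Ioi a, ENNReal.ofReal (B * t ^ (-p))
      = ENNReal.ofReal (B * a ^ (1 - p) / (p - 1)) := by
  have hp' : -p < -1 := neg_lt_neg hp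
  have hnonneg : ∀ᵐ t ∂volume.restrict (Set.Ioi a), 0 ≤ B * t ^ (-p) :=
    (ae_restrict_iff' measurableSet_Ioi).mpr (.of_forall fun t ht =>
      mul_nonneg hB (Real.rpow_nonneg (ha.trans ht).le _))
  rw [← ofReal_integral_eq_lintegral_ofReal ((integrableOn_Ioi_rpow_of_lt hp' ha).const_mul B)
    hnonneg, integral_const_mul, integral_Ioi_rpow_of_lt hp' ha, neg_add_eq_sub, neg_div,
    ← div_neg, neg_sub, mul_div_assoc]

lemma lintegral_ofReal_le_of_tail_le {f : Ω → ℝ} (hf : Measurable f) (hf₀ : ∀ ω, 0 ≤ f ω)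
    {B p : ℝ} (hB : 0 < B) (hp : 1 < p)
    (h : ∀ t, 0 < t → μ {ω | t ≤ f ω} ≤ ENNReal.ofReal (B * t ^ (-p))) :
    ∫⁻ ω, ENNReal.ofReal (f ω) ∂μ ≤ ENNReal.ofReal (p / (p - 1) * B ^ p⁻¹) := by
  have hp0 : 0 < p := one_pos.trans hp
  have hp1 : 0 < p - 1 := sub_pos.mpr hp
  set a : ℝ := B ^ p⁻¹ with ha
  have ha0 : 0 < a := by positivity
  have htail : B * a ^ (1 - p) = a := by
    rw [Real.rpow_sub ha0, Real.rpow_one, ha, Real.rpow_inv_rpow hB.le hp0.ne']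
    field_simp
  calc ∫⁻ ω, ENNReal.ofReal (f ω) ∂μ
      = ∫⁻ t in Set.Ioc 0 a ∪ Set.Ioi a, μ {ω | t ≤ f ω} := by
        rw [lintegral_eq_lintegral_meas_le μ (.of_forall hf₀) hf.aemeasurable,
          Set.Ioc_union_Ioi_eq_Ioi ha0.le]
    _ ≤ (∫⁻ _ in Set.Ioc 0 a, 1) + ∫⁻ t in Set.Ioi a, ENNReal.ofReal (B * t ^ (-p)) :=
        (lintegral_union_le _ _ _).trans (add_le_add (lintegral_mono fun _ => prob_le_one)
          (setLIntegral_mono (by fun_prop) fun t ht => h t (ha0.trans ht)))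
    _ = ENNReal.ofReal (a + a / (p - 1)) := by
        rw [lintegral_Ioi_const_mul_rpow_neg ha0 hB.le hp, htail, setLIntegral_one,
          Real.volume_Ioc, sub_zero, ← ENNReal.ofReal_add ha0.le (by positivity)]
    _ = ENNReal.ofReal (p / (p - 1) * a) := by
        congr 1; field_simp; ring

lemma lintegral_rpow_neg_le {ρ : Ω → ℝ} (hρ : Measurable ρ) (hρ₀ : ∀ ω, 0 ≤ ρ ω) {B e : ℝ}
    (hB : 0 < B) (he : 0 < e) (he₂ : e < 2)
    (h : ∀ r, 0 < r → μ {ω | ρ ω ≤ r} ≤ ENNReal.ofReal (B * r ^ 2)) :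
    ∫⁻ ω, ENNReal.ofReal (ρ ω ^ (-e)) ∂μ ≤ ENNReal.ofReal (2 / (2 - e) * B ^ (e / 2)) := by
  have htail : ∀ t, 0 < t → μ {ω | t ≤ ρ ω ^ (-e)} ≤ ENNReal.ofReal (B * t ^ (-(2 / e))) := by
    intro t ht
    have hsub : {ω | t ≤ ρ ω ^ (-e)} ⊆ {ω | ρ ω ≤ t ^ (-e⁻¹)} := fun ω hω => by
      have hpos : 0 < ρ ω := (hρ₀ ω).lt_of_ne fun h0 => by
        rw [Set.mem_ofPred_eq, ← h0, Real.zero_rpow (neg_ne_zero.mpr he.ne')] at hω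
        exact hω.not_gt ht
      rw [Set.mem_ofPred_eq, ← inv_neg]
      exact (Real.le_rpow_inv_iff_of_neg hpos ht (neg_neg_of_pos he)).mpr hω
    have hpow : (t ^ (-e⁻¹)) ^ 2 = t ^ (-(2 / e)) := by
      rw [← Real.rpow_mul_natCast ht.le]; congr 1; push_cast; ring
    exact (measure_mono hsub).trans (hpow ▸ h _ (by positivity))
  refine (lintegral_ofReal_le_of_tail_le μ (hρ.pow_const _)
    (fun ω => Real.rpow_nonneg (hρ₀ ω) _) hB ((one_lt_div he).mpr he₂) htail).trans_eq ?_
  have : 0 < 2 - e := sub_pos.mpr he₂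
  rw [inv_div]
  congr 2
  field_simp

end Moment

section Shift

open Matrix

/-- The matrix `M - z`, whose rows are the random vectors of the argument. -/
def shift {ι : Type*} [DecidableEq ι] (M : Matrix ι ι ℝ) (z : ℂ) : Matrix ι ι ℂ :=
  M.map (algebraMap ℝ ℂ) - z • 1

/-- The minor of an `ι × 2` matrix on the rows `j` and `k`. -/
def rowMinor {ι : Type*} (A : Matrix ι (Fin 2) ℂ) (j k : ι) : ℂ :=
  (A.submatrix ![j, k] id).det

/-- The columns of `H` are an orthonormal pair of vectors orthogonal (for the bilinear pairing) to
all rows of `B` other than `j` and `k`. Up to a unit factor, `rowMinor (B * H) j k` is then the area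
of the parallelogram spanned by the rows `j` and `k` modulo the other ones. -/
def IsAnnihilatingFrame {ι : Type*} [Fintype ι] (B : Matrix ι ι ℂ) (j k : ι)
    (H : Matrix ι (Fin 2) ℂ) : Prop :=
  Hᴴ * H = 1 ∧ ∀ l, l ≠ j → l ≠ k → (B * H) l = 0

/-- The vector of the plane spanned by the columns of `H` whose pairing with a row `v` of a matrix
is the determinant of `v ᵥ* H` and `c`. -/
def crossVec {ι : Type*} (H : Matrix ι (Fin 2) ℂ) (c : Fin 2 → ℂ) : ι → ℂ :=
  H *ᵥ ![c 1, -c 0]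

variable {ι : Type*}

lemma rowMinor_eq (A : Matrix ι (Fin 2) ℂ) (j k : ι) :
    rowMinor A j k = A j 0 * A k 1 - A j 1 * A k 0 := by
  exact det_fin_two _

lemma rowMinor_eq_zero {A : Matrix ι (Fin 2) ℂ} {j : ι} (hj : A j = 0) (k : ι) :
    rowMinor A j k = 0 := by
  simp [rowMinor_eq, hj]

variable [Fintype ι]

lemma mulVec_crossVec (B : Matrix ι ι ℂ) (H : Matrix ι (Fin 2) ℂ) (l k : ι) :
    (B *ᵥ crossVec H ((B * H) k)) l = rowMinor (B * H) l k := by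
  rw [crossVec, mulVec_mulVec, rowMinor_eq]
  simp [mulVec, dotProduct, Fin.sum_univ_two, sub_eq_add_neg]

lemma sum_norm_sq_crossVec {H : Matrix ι (Fin 2) ℂ} (hH : Hᴴ * H = 1) (c : Fin 2 → ℂ) :
    ∑ i, ‖crossVec H c i‖ ^ 2 = ∑ b, ‖c b‖ ^ 2 := by
  rw [crossVec, sum_norm_sq_mulVec hH]
  simp [Fin.sum_univ_two, add_comm]

lemma shift_mulVec_apply [DecidableEq ι] (M : Matrix ι ι ℝ) (z : ℂ) (f : ι → ℂ) (l : ι) :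
    (shift M z *ᵥ f) l = ∑ i, f i * (M l i : ℂ) + -(z * f l) := by
  rw [shift, sub_mulVec, smul_mulVec, one_mulVec]
  simp [mulVec, dotProduct, mul_comm, sub_eq_add_neg]

lemma shift_mul_apply [DecidableEq ι] {m : Type*} (M : Matrix ι ι ℝ) (z : ℂ) (H : Matrix ι m ℂ)
    (l : ι) (b : m) : (shift M z * H) l b = ∑ i, H i b * (M l i : ℂ) + -(z * H l b) :=
  shift_mulVec_apply M z (fun i => H i b) l

end Shift

section AnnihilatingFrame

open Matrix

lemma exists_isometry_mul_eq_zero {m ι d : Type*} [Fintype m] [Fintype ι] [Fintype d]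
    [DecidableEq d] (A : Matrix m ι ℂ)
    (hcard : Fintype.card m + Fintype.card d ≤ Fintype.card ι) :
    ∃ H : Matrix ι d ℂ, Hᴴ * H = 1 ∧ A * H = 0 := by
  let T : EuclideanSpace ℂ ι →ₗ[ℂ] (m → ℂ) :=
    A.mulVecLin ∘ₗ (WithLp.linearEquiv 2 ℂ (ι → ℂ)).toLinearMap
  have hrank : Fintype.card d ≤ Fintype.card (Fin (Module.finrank ℂ T.ker)) := by
    have hadd := T.finrank_range_add_finrank_ker
    have hle := Submodule.finrank_le T.range
    rw [Module.finrank_fintype_fun_eq_card] at hle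
    rw [finrank_euclideanSpace] at hadd
    rw [Fintype.card_fin]
    omega
  obtain ⟨e⟩ := Function.Embedding.nonempty_of_card_le hrank
  let b := stdOrthonormalBasis ℂ T.ker
  refine ⟨of fun i a => (b (e a) : EuclideanSpace ℂ ι) i, ?_, ?_⟩
  · ext a a'
    have horth := orthonormal_iff_ite.mp (b.orthonormal.comp e e.injective) a a'
    rw [Function.comp_apply, Function.comp_apply, Submodule.coe_inner, PiLp.inner_apply] at horth
    simpa [mul_apply, one_apply, mul_comm] using horth
  · ext l a
    exact congrFun (LinearMap.mem_ker.mp (b (e a)).2) l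

variable {ι : Type*} [Fintype ι]

lemma exists_isAnnihilatingFrame (B : Matrix ι ι ℂ) {j k : ι} (hjk : j ≠ k) :
    ∃ H, IsAnnihilatingFrame B j k H := by
  classical
  have hcard : Fintype.card {l : ι // l ∉ ({j, k} : Finset ι)} + Fintype.card (Fin 2)
      ≤ Fintype.card ι := by
    have hle := Finset.card_le_univ ({j, k} : Finset ι)
    rw [Finset.card_pair hjk] at hle
    rw [Fintype.card_subtype_compl, Fintype.card_coe, Finset.card_pair hjk, Fintype.card_fin,
      Nat.sub_add_cancel hle]
  obtain ⟨H, hH, hBH⟩ := exists_isometry_mul_eq_zero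
    (B.submatrix (Subtype.val : {l : ι // l ∉ ({j, k} : Finset ι)} → ι) id) hcard
  exact ⟨H, hH, fun l hj hk => congrFun hBH ⟨l, by simp [hj, hk]⟩⟩

lemma isCompact_setOf_isometry {d : Type*} [DecidableEq d] :
    IsCompact {H : Matrix ι d ℂ | Hᴴ * H = 1} := by
  refine IsCompact.of_isClosed_subset
    (isCompact_univ_pi fun _ => isCompact_univ_pi fun _ => isCompact_closedBall (0 : ℂ) 1)
    (isClosed_eq (by fun_prop) continuous_const) fun H hH i _ b _ => ?_
  rw [mem_closedBall_zero_iff, ← sq_le_one_iff₀ (norm_nonneg _), ← sum_norm_sq_col hH b]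
  exact Finset.single_le_sum (f := fun i => ‖H i b‖ ^ 2) (fun _ _ => by positivity)
    (Finset.mem_univ i)

end AnnihilatingFrame

section ImaginaryPart

open Matrix WithLp

lemma im_shift_mulVec {ι : Type*} [Fintype ι] [DecidableEq ι] (M : Matrix ι ι ℝ) (z : ℂ)
    (g : ι → ℂ) (l : ι) :
    ((shift M z *ᵥ g) l).im = (M *ᵥ fun i => (g i).im) l - z.re * (g l).im - z.im * (g l).re := by
  rw [shift_mulVec_apply]
  simp only [Complex.add_im, Complex.im_sum, Complex.im_mul_ofReal, Complex.neg_im,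
    Complex.mul_im z, mulVec, dotProduct, mul_comm (M l _)]
  ring

lemma norm_toLp_mulVec_le {n : ℕ} (M : Matrix (Fin n) (Fin n) ℝ) (v : Fin n → ℝ) :
    ‖toLp 2 (M *ᵥ v)‖ ≤ opNorm M * ‖toLp 2 v‖ :=
  (toEuclideanCLM (𝕜 := ℝ) M).le_opNorm (toLp 2 v)

variable {ι : Type*} [Fintype ι]

lemma norm_toLp_sq_eq_re_add_im (g : ι → ℂ) :
    ‖toLp 2 g‖ ^ 2 = ‖toLp 2 fun i => (g i).re‖ ^ 2 + ‖toLp 2 fun i => (g i).im‖ ^ 2 := by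
  simp only [EuclideanSpace.norm_sq_eq, ← Finset.sum_add_distrib, Complex.sq_norm,
    Complex.normSq_apply, Real.norm_eq_abs, sq_abs, ← sq]

lemma norm_toLp_le_re_add_im (g : ι → ℂ) :
    ‖toLp 2 g‖ ≤ ‖toLp 2 fun i => (g i).re‖ + ‖toLp 2 fun i => (g i).im‖ := by
  refine le_of_sq_le_sq ?_ (by positivity)
  rw [norm_toLp_sq_eq_re_add_im, add_sq]
  linarith [mul_nonneg (norm_nonneg (toLp 2 fun i => (g i).re))
    (norm_nonneg (toLp 2 fun i => (g i).im))]

lemma norm_toLp_im_le (g : ι → ℂ) : ‖toLp 2 fun i => (g i).im‖ ≤ ‖toLp 2 g‖ := by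
  refine le_of_sq_le_sq ?_ (norm_nonneg _)
  rw [norm_toLp_sq_eq_re_add_im]
  exact le_add_of_nonneg_left (by positivity)

/- Imaginary parts in `M g ≈ z g` give `Im z * Re g ≈ (M - Re z) Im g`, so that `Im g` controls
`Re g` and cannot be small. -/
lemma abs_im_mul_norm_le {n : ℕ} (M : Matrix (Fin n) (Fin n) ℝ) (z : ℂ) (g : Fin n → ℂ) :
    |z.im| * ‖toLp 2 g‖ ≤ (opNorm M + |z.re| + |z.im|) * ‖toLp 2 fun i => (g i).im‖
      + ‖toLp 2 (shift M z *ᵥ g)‖ := by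
  set p : EuclideanSpace ℝ (Fin n) := toLp 2 fun i => (g i).re
  set q : EuclideanSpace ℝ (Fin n) := toLp 2 fun i => (g i).im
  set e : EuclideanSpace ℝ (Fin n) := toLp 2 fun i => ((shift M z *ᵥ g) i).im
  have hre : z.im • p = toLp 2 (M *ᵥ fun i => (g i).im) - z.re • q - e := by
    ext l
    simp only [p, q, e, PiLp.sub_apply, PiLp.smul_apply, smul_eq_mul, im_shift_mulVec]
    ring
  have hp : |z.im| * ‖p‖ ≤ opNorm M * ‖q‖ + |z.re| * ‖q‖ + ‖toLp 2 (shift M z *ᵥ g)‖ := by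
    rw [← Real.norm_eq_abs, ← norm_smul, hre, ← Real.norm_eq_abs z.re, ← norm_smul z.re q]
    exact (norm_sub_le _ _).trans (add_le_add ((norm_sub_le _ _).trans
      (add_le_add_left (norm_toLp_mulVec_le M _) _)) (norm_toLp_im_le _))
  calc |z.im| * ‖toLp 2 g‖ ≤ |z.im| * (‖p‖ + ‖q‖) := by
        gcongr; exact norm_toLp_le_re_add_im g
    _ ≤ _ := by linarith

lemma le_sum_im_sq {n : ℕ} {M : Matrix (Fin n) (Fin n) ℝ} {z : ℂ} {R t ρ : ℝ} (hM : opNorm M ≤ R)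
    (hR : 0 < R) (hre : |z.re| ≤ 2 * R) (him : |z.im| ≤ 2 * R) {f : Fin n → ℂ} {j : Fin n}
    (hf : ∀ l, l ≠ j → (shift M z *ᵥ f) l = 0) (hfj : ‖(shift M z *ᵥ f) j‖ ≤ t) (hρ : 0 ≤ ρ)
    (hfρ : ∑ i, ‖f i‖ ^ 2 = ρ ^ 2) (ht : 2 * t ≤ |z.im| * ρ) {ω : ℂ} (hω : ‖ω‖ = 1) :
    (|z.im| * ρ / (10 * R)) ^ 2 ≤ ∑ i, (ω * f i).im ^ 2 := by
  have hnorm : ‖toLp 2 (ω • f)‖ = ρ := by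
    rw [← sq_eq_sq₀ (norm_nonneg _) hρ, ← hfρ, EuclideanSpace.norm_sq_eq]
    simp [hω]
  have hres : ‖toLp 2 (shift M z *ᵥ (ω • f))‖ ≤ t := by
    have hsingle : shift M z *ᵥ f = Pi.single j ((shift M z *ᵥ f) j) := by
      ext l
      rcases eq_or_ne l j with rfl | hl
      · rw [Pi.single_eq_same]
      · rw [Pi.single_eq_of_ne hl, hf l hl]
    rw [mulVec_smul, hsingle, toLp_smul, norm_smul, hω, one_mul]
    exact (PiLp.norm_single 2 _ j _).trans_le hfj
  have hq : ∑ i, (ω * f i).im ^ 2 = ‖toLp 2 fun i => ((ω • f) i).im‖ ^ 2 := by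
    simp [EuclideanSpace.norm_sq_eq]
  have hmain := abs_im_mul_norm_le M z (ω • f)
  rw [hnorm] at hmain
  have hcoeff : (opNorm M + |z.re| + |z.im|) * ‖toLp 2 fun i => ((ω • f) i).im‖
      ≤ 5 * R * ‖toLp 2 fun i => ((ω • f) i).im‖ := by
    gcongr; linarith
  rw [hq]
  gcongr
  rw [div_le_iff₀ (by positivity)]
  linarith

end ImaginaryPart

section ThinSet

open Matrix

lemma IsAnnihilatingFrame.congr {ι : Type*} [Fintype ι] {B B' : Matrix ι ι ℂ} {j k : ι}
    {H : Matrix ι (Fin 2) ℂ} (h : IsAnnihilatingFrame B j k H)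
    (hB : ∀ l, l ≠ j → l ≠ k → B' l = B l) : IsAnnihilatingFrame B' j k H :=
  ⟨h.1, fun l hj hk => by
    rw [mul_apply_eq_vecMul, hB l hj hk, ← mul_apply_eq_vecMul, h.2 l hj hk]⟩

lemma IsAnnihilatingFrame.mulVec_crossVec_eq_zero {ι : Type*} [Fintype ι] {B : Matrix ι ι ℂ}
    {j k l : ι} {H : Matrix ι (Fin 2) ℂ} (h : IsAnnihilatingFrame B j k H) (hl : l ≠ j) :
    (B *ᵥ crossVec H ((B * H) k)) l = 0 := by
  rw [mulVec_crossVec]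
  rcases eq_or_ne l k with rfl | hlk
  · rw [rowMinor_eq, mul_comm, sub_self]
  · exact rowMinor_eq_zero (h.2 l hl hlk) k

lemma shift_of_update_of_ne {ι : Type*} [DecidableEq ι] (X : ι → ι → ℝ) (z : ℂ) {l j : ι}
    (hl : l ≠ j) (v : ι → ℝ) : shift (of (Function.update X j v)) z l = shift (of X) z l := by
  ext i
  simp [shift, Function.update_of_ne hl]

variable {n : ℕ}

/-- The matrices of norm at most `R` such that the rows `j` and `k` of `M - z` span a parallelogram
of area less than `t` modulo the other rows. Matrices are encoded by their families of rows, which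
carry the product measures. -/
def thinSet (z : ℂ) (R t : ℝ) (j k : Fin n) : Set (Fin n → Fin n → ℝ) :=
  {x | opNorm (of x) ≤ R ∧ ∀ H, IsAnnihilatingFrame (shift (of x) z) j k H →
    ‖rowMinor (shift (of x) z * H) j k‖ < t}

lemma continuous_opNorm : Continuous fun x : Fin n → Fin n → ℝ => opNorm (of x) := by
  have hclm := (toEuclideanCLM (n := Fin n) (𝕜 := ℝ)).toAlgEquiv.toLinearMap
    |>.continuous_of_finiteDimensional
  exact (hclm.comp
    (f := (of : (Fin n → Fin n → ℝ) → Matrix (Fin n) (Fin n) ℝ)) continuous_id).norm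

lemma continuous_shift_mul_apply {d : Type*} (z : ℂ) (l : Fin n) (b : d) :
    Continuous fun q : (Fin n → Fin n → ℝ) × Matrix (Fin n) d ℂ =>
      (shift (of q.1) z * q.2) l b := by
  have (i : Fin n) :
      Continuous fun q : (Fin n → Fin n → ℝ) × Matrix (Fin n) d ℂ => q.2 i b :=
    continuous_snd.matrix_elem i b
  simp only [shift_mul_apply, of_apply]
  fun_prop

lemma isClosed_image_fst_of_isCompact {X Y : Type*} [TopologicalSpace X] [TopologicalSpace Y]
    {K : Set Y} (hK : IsCompact K) {W : Set (X × Y)} (hW : IsClosed W) :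
    IsClosed {x | ∃ y ∈ K, (x, y) ∈ W} := by
  have : CompactSpace K := isCompact_iff_compactSpace.mp hK
  convert isClosedMap_fst_of_compactSpace (X := X) (Y := K) _
    (hW.preimage (continuous_id.prodMap continuous_subtype_val)) using 1
  ext x
  simp

lemma measurableSet_thinSet (z : ℂ) (R t : ℝ) (j k : Fin n) :
    MeasurableSet (thinSet z R t j k) := by
  let W : Set ((Fin n → Fin n → ℝ) × Matrix (Fin n) (Fin 2) ℂ) := {q |
    (∀ l, l ≠ j → l ≠ k → (shift (of q.1) z * q.2) l = 0) ∧
      t ≤ ‖rowMinor (shift (of q.1) z * q.2) j k‖}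
  have hW : IsClosed W := by
    have hcont := continuous_shift_mul_apply (n := n) (d := Fin 2) z
    simp only [W, rowMinor_eq, Set.ofPred_and, Set.ofPred_forall]
    exact (isClosed_iInter fun l => isClosed_iInter fun _ => isClosed_iInter fun _ =>
      isClosed_eq (continuous_pi (hcont l)) continuous_const).inter
        (isClosed_le continuous_const (((hcont j 0).mul (hcont k 1)).sub
          ((hcont j 1).mul (hcont k 0))).norm)
  have heq : thinSet z R t j k = {x | opNorm (of x) ≤ R}
      ∩ {x | ∃ H ∈ {H : Matrix (Fin n) (Fin 2) ℂ | Hᴴ * H = 1}, (x, H) ∈ W}ᶜ := by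
    ext x
    refine and_congr_right fun _ => ⟨?_, fun hx H hH => ?_⟩
    · rintro hx ⟨H, hH, hl, ht⟩
      exact (hx H ⟨hH, hl⟩).not_ge ht
    · by_contra! ht
      exact hx ⟨H, hH.1, hH.2, ht⟩
  rw [heq]
  exact (isClosed_le continuous_opNorm continuous_const).measurableSet.inter
    (isClosed_image_fst_of_isCompact isCompact_setOf_isometry hW).measurableSet.compl

lemma le_ofReal_sqrt_pow_three_mul {m : ENNReal} {α c : ℝ} (hα : 0 ≤ α) (hc : 0 ≤ c)
    (h₁ : m ≤ ENNReal.ofReal α) (h₂ : m ≤ ENNReal.ofReal (α * (α * c))) :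
    m ≤ ENNReal.ofReal √(α ^ 3 * c) := by
  rcases le_total 1 (α * c) with h | h
  · refine h₁.trans (ENNReal.ofReal_le_ofReal (Real.le_sqrt_of_sq_le ?_))
    nlinarith [mul_le_mul_of_nonneg_left h (sq_nonneg α)]
  · refine h₂.trans (ENNReal.ofReal_le_ofReal (Real.le_sqrt_of_sq_le ?_))
    have hnonneg : 0 ≤ α ^ 3 * c := by positivity
    nlinarith [mul_le_mul_of_nonneg_left h hnonneg]

lemma mulVec_crossVec_of_update_mem_thinSet {z : ℂ} {R t : ℝ} {X : Fin n → Fin n → ℝ} {j k : Fin n}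
    (hjk : j ≠ k) {H : Matrix (Fin n) (Fin 2) ℂ} (hH : IsAnnihilatingFrame (shift (of X) z) j k H)
    {v : Fin n → ℝ} (hv : Function.update X j v ∈ thinSet z R t j k) :
    (∀ l, l ≠ j → (shift (of (Function.update X j v)) z *ᵥ
        crossVec H ((shift (of X) z * H) k)) l = 0) ∧
      ‖(shift (of (Function.update X j v)) z *ᵥ crossVec H ((shift (of X) z * H) k)) j‖ ≤ t := by
  have hframe := hH.congr fun l hl _ => shift_of_update_of_ne X z hl v
  rw [mul_apply_eq_vecMul, ← shift_of_update_of_ne X z hjk.symm v, ← mul_apply_eq_vecMul]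
  refine ⟨fun l hl => hframe.mulVec_crossVec_eq_zero hl, ?_⟩
  rw [mulVec_crossVec]
  exact (hv.2 H hframe).le

lemma pi_update_mem_thinSet_le {ν : Fin n → Measure ℝ} [∀ i, IsProbabilityMeasure (ν i)] {κ : ℝ}
    (hκ : 0 < κ) (hν : ∀ i, ν i ≤ ENNReal.ofReal κ • volume) {z : ℂ} {R : ℝ} (hR : 0 < R)
    (hre : |z.re| ≤ 2 * R) (him : |z.im| ≤ 2 * R) (hz : 0 < |z.im|) {t : ℝ} (ht : 0 ≤ t)
    {X : Fin n → Fin n → ℝ} {j k : Fin n} (hjk : j ≠ k) {H : Matrix (Fin n) (Fin 2) ℂ}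
    (hH : IsAnnihilatingFrame (shift (of X) z) j k H) {ρ : ℝ} (hρ : 0 < ρ)
    (hρH : ∑ b, ‖(shift (of X) z * H) k b‖ ^ 2 = ρ ^ 2) :
    Measure.pi ν {v | Function.update X j v ∈ thinSet z R t j k}
      ≤ ENNReal.ofReal √((2 * κ * √n * t / ρ) ^ 3 * ((10 * R + 1 / (κ * √n)) / |z.im|)) := by
  have hn : 0 < √(n : ℝ) := Real.sqrt_pos.mpr (Nat.cast_pos.mpr j.pos)
  set f := crossVec H ((shift (of X) z * H) k)
  have hfρ : ∑ i, ‖f i‖ ^ 2 = ρ ^ 2 := (sum_norm_sq_crossVec hH.1 _).trans hρH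
  have hthin (v : Fin n → ℝ) (hv : Function.update X j v ∈ thinSet z R t j k) :=
    mulVec_crossVec_of_update_mem_thinSet hjk hH hv
  have hmono : {v | Function.update X j v ∈ thinSet z R t j k}
      ⊆ {v | ‖∑ i, f i * (v i : ℂ) + -(z * f j)‖ ≤ t} := fun v hv => by
    simpa [shift_mulVec_apply] using (hthin v hv).2
  have hnorm := (measure_mono hmono).trans
    (pi_affine_le_of_norm hκ.le hν f (-(z * f j)) ht hρ hfρ.ge)
  rw [Fintype.card_fin] at hnorm
  refine le_ofReal_sqrt_pow_three_mul (by positivity) (by positivity) hnorm ?_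
  rcases Set.eq_empty_or_nonempty {v | Function.update X j v ∈ thinSet z R t j k}
    with hempty | ⟨v, hv⟩
  · simp [hempty]
  rcases le_or_gt (2 * t) (|z.im| * ρ) with hsmall | hlarge
  · refine ((measure_mono hmono).trans (pi_affine_le_of_im hκ.le hν f _ ht hρ hfρ.ge
      (b := |z.im| * ρ / (10 * R)) (by positivity) fun ω hω => le_sum_im_sq hv.1 hR hre him
        (hthin v hv).1 (hthin v hv).2 hρ.le hfρ hsmall hω)).trans (ENNReal.ofReal_le_ofReal ?_)
    rw [Fintype.card_fin]
    calc _ = 2 * κ * √n * t / ρ * (2 * κ * √n * t / ρ * (10 * R / |z.im|)) := by field_simp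
      _ ≤ _ := by
        gcongr
        exact le_add_of_nonneg_right (by positivity)
  · refine hnorm.trans (ENNReal.ofReal_le_ofReal (le_mul_of_one_le_right (by positivity) ?_))
    calc 1 ≤ 2 * t / (|z.im| * ρ) := by rw [one_le_div (by positivity)]; exact hlarge.le
      _ = 2 * κ * √n * t / ρ * (1 / (κ * √n) / |z.im|) := by field_simp
      _ ≤ _ := by
        gcongr
        exact le_add_of_nonneg_left (by positivity)

lemma pi_le_of_forall_two_rows {ι : Type*} [Fintype ι] [DecidableEq ι] {E : ι → Type*}
    [∀ i, MeasurableSpace (E i)] (μ : ∀ i, Measure (E i)) [∀ i, IsProbabilityMeasure (μ i)]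
    (j k : ι) {S : Set (∀ i, E i)} (hS : MeasurableSet S) {b : ENNReal}
    (h : ∀ x, ∫⁻ u, μ j {v | Function.update (Function.update x k u) j v ∈ S} ∂μ k ≤ b) :
    Measure.pi μ S ≤ b := by
  have hind : Measurable (S.indicator (1 : (∀ i, E i) → ENNReal)) := measurable_one.indicator hS
  have hsection (x : ∀ i, E i) : ∫⁻ v, S.indicator (1 : (∀ i, E i) → ENNReal)
      (Function.update x j v) ∂μ j = μ j {v | Function.update x j v ∈ S} :=
    lintegral_indicator_one (measurable_update x hS)
  have hmeas : Measurable fun x => μ j {v | Function.update x j v ∈ S} := by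
    have hlm := Measurable.lmarginal (s := {j}) μ hind
    rw [lmarginal_singleton] at hlm
    simpa only [hsection] using hlm
  rw [← lintegral_indicator_one hS, lintegral_pi_update μ j hind]
  simp_rw [hsection]
  rw [lintegral_pi_update μ k hmeas]
  exact (lintegral_mono h).trans_eq (by simp)

/-- The length of row `k` of `M - z` modulo the other rows, as a function of that row of `M`, when
the columns of `H` are orthonormal and annihilated by the other rows. -/
def rowLength (z : ℂ) (H : Matrix (Fin n) (Fin 2) ℂ) (k : Fin n) (u : Fin n → ℝ) : ℝ :=
  √(∑ b, ‖∑ i, H i b * (u i : ℂ) + -(z * H k b)‖ ^ 2)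

lemma measurable_rowLength (z : ℂ) (H : Matrix (Fin n) (Fin 2) ℂ) (k : Fin n) :
    Measurable (rowLength z H k) := by
  unfold rowLength
  fun_prop

lemma pi_rowLength_le {ν : Fin n → Measure ℝ} [∀ i, IsProbabilityMeasure (ν i)] {κ : ℝ}
    (hκ : 0 ≤ κ) (hν : ∀ i, ν i ≤ ENNReal.ofReal κ • volume) {H : Matrix (Fin n) (Fin 2) ℂ}
    (hH : Hᴴ * H = 1) (z : ℂ) (k : Fin n) {r : ℝ} (hr : 0 ≤ r) :
    Measure.pi ν {u | rowLength z H k u ≤ r} ≤ ENNReal.ofReal (8 * κ ^ 2 * n * r ^ 2) := by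
  have hframe := pi_frame_le hH hκ hν (fun b => -(z * H k b)) hr
  rw [Fintype.card_fin] at hframe
  refine (measure_mono fun u hu b => ?_).trans hframe
  exact (Real.le_sqrt_of_sq_le (Finset.single_le_sum
    (f := fun b => ‖∑ i, H i b * (u i : ℂ) + -(z * H k b)‖ ^ 2) (fun _ _ => by positivity)
    (Finset.mem_univ b))).trans hu

lemma ae_rowLength_pos {ν : Fin n → Measure ℝ} [∀ i, IsProbabilityMeasure (ν i)] {κ : ℝ}
    (hκ : 0 ≤ κ) (hν : ∀ i, ν i ≤ ENNReal.ofReal κ • volume) {H : Matrix (Fin n) (Fin 2) ℂ}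
    (hH : Hᴴ * H = 1) (z : ℂ) (k : Fin n) : ∀ᵐ u ∂Measure.pi ν, 0 < rowLength z H k u := by
  rw [ae_iff]
  simpa using pi_rowLength_le hκ hν hH z k le_rfl

lemma sqrt_div_pow_three_mul {a ρ : ℝ} (ha : 0 ≤ a) (hρ : 0 < ρ) {c : ℝ} (hc : 0 ≤ c) :
    √((a / ρ) ^ 3 * c) = √(a ^ 3 * c) * ρ ^ (-(3 / 2) : ℝ) := by
  have hpow : √(ρ ^ 3) = ρ ^ (3 / 2 : ℝ) := by
    rw [Real.sqrt_eq_rpow, ← Real.rpow_natCast, ← Real.rpow_mul hρ.le]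
    norm_num
  rw [div_pow, div_mul_eq_mul_div, Real.sqrt_div (by positivity), hpow, Real.rpow_neg hρ.le,
    div_eq_mul_inv]

lemma sqrt_mul_rpow_le {a b : ℝ} (ha : 0 ≤ a) (hb : 0 ≤ b) (m : ℕ) :
    √a * (8 * b ^ 2 * m) ^ (3 / 4 : ℝ) ≤ √(a * (3 * b * √m) ^ 3) := by
  have hsq : ((3 * b * √m) ^ 2) ^ (3 / 4 : ℝ) = √((3 * b * √m) ^ 3) := by
    rw [Real.sqrt_eq_rpow (_ ^ 3), ← Real.rpow_natCast _ 2, ← Real.rpow_natCast _ 3,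
      ← Real.rpow_mul (by positivity), ← Real.rpow_mul (by positivity)]
    norm_num
  rw [Real.sqrt_mul ha, ← hsq]
  gcongr
  rw [mul_pow, Real.sq_sqrt m.cast_nonneg, mul_pow]
  gcongr
  norm_num

variable {ν : Fin n → Fin n → Measure ℝ} [∀ j i, IsProbabilityMeasure (ν j i)] {κ : ℝ}

lemma pi_thinSet_le (hκ : 0 < κ) (hν : ∀ j i, ν j i ≤ ENNReal.ofReal κ • volume) {z : ℂ} {R : ℝ}
    (hR : 0 < R) (hre : |z.re| ≤ 2 * R) (him : |z.im| ≤ 2 * R) (hz : 0 < |z.im|)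
    {t : ℝ} (ht : 0 ≤ t) {j k : Fin n} (hjk : j ≠ k) :
    Measure.pi (fun j => Measure.pi (ν j)) (thinSet z R t j k)
      ≤ ENNReal.ofReal
          (4 * √((6 * κ ^ 2 * n * t) ^ 3 * ((10 * R + 1 / (κ * √n)) / |z.im|))) := by
  have hn : 0 < (n : ℝ) := Nat.cast_pos.mpr j.pos
  set c := (10 * R + 1 / (κ * √n)) / |z.im|
  have hc₀ : 0 ≤ c := by positivity
  refine pi_le_of_forall_two_rows _ j k (measurableSet_thinSet z R t j k) fun x => ?_
  obtain ⟨H, hH⟩ := exists_isAnnihilatingFrame (shift (of x) z) hjk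
  have hrow (u : Fin n → ℝ) (hu : 0 < rowLength z H k u) :
      Measure.pi (ν j) {v | Function.update (Function.update x k u) j v ∈ thinSet z R t j k}
        ≤ ENNReal.ofReal √((2 * κ * √n * t) ^ 3 * c)
          * ENNReal.ofReal (rowLength z H k u ^ (-(3 / 2) : ℝ)) := by
    rw [← ENNReal.ofReal_mul (by positivity), ← sqrt_div_pow_three_mul (by positivity) hu hc₀]
    refine pi_update_mem_thinSet_le hκ (hν j) hR hre him hz ht hjk
      (hH.congr fun l _ hl => shift_of_update_of_ne x z hl u) hu ?_
    rw [rowLength, Real.sq_sqrt (by positivity)]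
    simp [shift_mul_apply]
  calc _ ≤ ∫⁻ u, ENNReal.ofReal √((2 * κ * √n * t) ^ 3 * c)
          * ENNReal.ofReal (rowLength z H k u ^ (-(3 / 2) : ℝ)) ∂Measure.pi (ν k) :=
        lintegral_mono_ae ((ae_rowLength_pos hκ.le (hν k) hH.1 z k).mono hrow)
    _ = ENNReal.ofReal √((2 * κ * √n * t) ^ 3 * c)
          * ∫⁻ u, ENNReal.ofReal (rowLength z H k u ^ (-(3 / 2) : ℝ)) ∂Measure.pi (ν k) :=
        lintegral_const_mul' _ _ ENNReal.ofReal_ne_top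
    _ ≤ ENNReal.ofReal √((2 * κ * √n * t) ^ 3 * c)
          * ENNReal.ofReal (2 / (2 - 3 / 2) * (8 * κ ^ 2 * n) ^ ((3 / 2 : ℝ) / 2)) := by
        gcongr
        exact lintegral_rpow_neg_le _ (measurable_rowLength z H k)
          (fun u => Real.sqrt_nonneg _) (by positivity) (by norm_num) (by norm_num)
          fun r hr => pi_rowLength_le hκ.le (hν k) hH.1 z k hr.le
    _ = ENNReal.ofReal (4 * (√((2 * κ * √n * t) ^ 3 * c) * (8 * κ ^ 2 * n) ^ (3 / 4 : ℝ))) := by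
        rw [← ENNReal.ofReal_mul (by positivity)]
        norm_num
        ring_nf
    _ ≤ ENNReal.ofReal (4 * √((2 * κ * √n * t) ^ 3 * c * (3 * κ * √n) ^ 3)) := by
        gcongr
        exact sqrt_mul_rpow_le (by positivity) hκ.le n
    _ = ENNReal.ofReal (4 * √((6 * κ ^ 2 * √n ^ 2 * t) ^ 3 * c)) := by ring_nf
    _ = _ := by rw [Real.sq_sqrt hn.le]

end ThinSet

section TriangularPair

lemma exists_notMem_and_apply_mem {R V : Type*} [Semiring R] [AddCommMonoid V] [Module R V]
    {S : Module.End R V} {p : Submodule R V} {w : V} (hw : w ∉ p) {m : ℕ} (hm : (S ^ m) w ∈ p) :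
    ∃ w', w' ∉ p ∧ S w' ∈ p := by
  induction m generalizing w with
  | zero => exact absurd hm hw
  | succ m ih =>
    by_cases hSw : S w ∈ p
    · exact ⟨w, hw, hSw⟩
    · exact ih hSw (by rwa [pow_succ] at hm)

section Algebra

variable {K V : Type*} [Field K] [AddCommGroup V] [Module K V] [FiniteDimensional K V]
  {T : Module.End K V}

lemma exists_hasEigenvector_of_mem_roots {a : K} (ha : a ∈ T.charpoly.roots) :
    ∃ v, T.HasEigenvector a v :=
  ((Module.End.hasEigenvalue_iff_isRoot_charpoly T a).mpr
    (Polynomial.isRoot_of_mem_roots ha)).exists_hasEigenvector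

lemma exists_mem_maxGenEigenspace_notMem_span {a b : K} (h : {a, b} ≤ T.charpoly.roots) {v : V}
    (hv : T.HasEigenvector a v) : ∃ w ∈ T.maxGenEigenspace b, w ∉ Submodule.span K {v} := by
  classical
  rcases eq_or_ne a b with rfl | hab
  · by_contra! hle
    have hcount : 2 ≤ Module.finrank K (T.maxGenEigenspace a) := by
      rw [LinearMap.finrank_maxGenEigenspace_eq, ← Polynomial.count_roots]
      simpa using Multiset.count_le_of_le a h
    have hfinrank := Submodule.finrank_mono (s := T.maxGenEigenspace a) hle
    rw [finrank_span_singleton hv.2] at hfinrank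
    omega
  · obtain ⟨w, hw⟩ :=
      exists_hasEigenvector_of_mem_roots (Multiset.mem_of_le h (a := b) (by simp))
    refine ⟨w, T.genEigenspace_le_maximal b 1 hw.1, fun hmem => ?_⟩
    obtain ⟨c, rfl⟩ := Submodule.mem_span_singleton.mp hmem
    have hTw := hw.apply_eq_smul
    rw [map_smul, hv.apply_eq_smul, smul_comm, ← sub_eq_zero, ← sub_smul] at hTw
    exact (smul_ne_zero (sub_ne_zero.mpr hab) hw.2) hTw

lemma exists_hasEigenvector_and_apply_sub_smul_mem_span {a b : K} (h : {a, b} ≤ T.charpoly.roots) :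
    ∃ v w, T.HasEigenvector a v ∧ w ∉ Submodule.span K {v} ∧
      T w - b • w ∈ Submodule.span K {v} := by
  obtain ⟨v, hv⟩ := exists_hasEigenvector_of_mem_roots (Multiset.mem_of_le h (a := a) (by simp))
  obtain ⟨w, hw, hwv⟩ := exists_mem_maxGenEigenspace_notMem_span h hv
  obtain ⟨m, hm⟩ := (T.mem_maxGenEigenspace b w).mp hw
  obtain ⟨w', hw', hTw'⟩ := exists_notMem_and_apply_mem hwv (hm ▸ Submodule.zero_mem _)
  exact ⟨v, w', hv, hw', hTw'⟩

end Algebra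

lemma exists_orthonormal_triangular_pair {E : Type*} [NormedAddCommGroup E]
    [InnerProductSpace ℂ E] [FiniteDimensional ℂ E] {T : Module.End ℂ E} {a b : ℂ}
    (h : {a, b} ≤ T.charpoly.roots) :
    ∃ v w : E, Orthonormal ℂ ![v, w] ∧ T v = a • v ∧ ∃ c : ℂ, T w = b • w + c • v := by
  obtain ⟨v, w, hv, hwv, hTw⟩ := exists_hasEigenvector_and_apply_sub_smul_mem_span h
  let p := Submodule.span ℂ {v}
  have hTp (x : E) (hx : x ∈ p) : T x = a • x := by
    obtain ⟨c, rfl⟩ := Submodule.mem_span_singleton.mp hx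
    rw [map_smul, hv.apply_eq_smul, smul_comm]
  let u := w - p.starProjection w
  have hu : u ≠ 0 := fun h0 => hwv (by
    rw [sub_eq_zero.mp h0]
    exact p.starProjection_apply_mem w)
  have hTu : T u - b • u ∈ p := by
    have hdiff : T u - b • u
        = (T w - b • w) - (a • p.starProjection w - b • p.starProjection w) := by
      rw [map_sub, hTp _ (p.starProjection_apply_mem w)]
      module
    rw [hdiff]
    exact p.sub_mem hTw (p.sub_mem (p.smul_mem _ (p.starProjection_apply_mem w))
      (p.smul_mem _ (p.starProjection_apply_mem w)))
  obtain ⟨c, hc⟩ := Submodule.mem_span_singleton.mp hTu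
  have horth : inner ℂ v u = 0 :=
    p.inner_right_of_mem_orthogonal (Submodule.mem_span_singleton_self v)
      (p.sub_starProjection_mem_orthogonal w)
  have hv₀ : (‖v‖ : ℂ) ≠ 0 := by simpa using hv.2
  refine ⟨(‖v‖ : ℂ)⁻¹ • v, (‖u‖ : ℂ)⁻¹ • u, ?_, ?_, (‖u‖ : ℂ)⁻¹ * c * ‖v‖, ?_⟩
  · simp [orthonormal_vecCons_iff, inner_smul_left, inner_smul_right, horth, norm_smul, hv.2, hu]
  · exact hTp _ (p.smul_mem _ (Submodule.mem_span_singleton_self v))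
  · rw [map_smul, eq_add_of_sub_eq hc.symm, smul_smul _ _ v, mul_assoc, mul_inv_cancel₀ hv₀]
    module

open Matrix

variable {ι : Type*} [Fintype ι]

lemma exists_isometry_mul_eq_triangular [DecidableEq ι] {M : Matrix ι ι ℂ} {a b : ℂ}
    (h : {a, b} ≤ M.charpoly.roots) :
    ∃ V : Matrix ι (Fin 2) ℂ, Vᴴ * V = 1 ∧ ∃ c : ℂ, M * V = V * !![a, c; 0, b] := by
  have hchar : (toLpLin 2 2 M).charpoly = M.charpoly := by
    rw [toLpLin_eq_toLin, charpoly_toLin]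
  obtain ⟨v, w, hvw, hv, c, hw⟩ :=
    exists_orthonormal_triangular_pair (T := toLpLin 2 2 M) (hchar ▸ h)
  refine ⟨of fun i d => ![v, w] d i, ?_, c, ?_⟩
  · ext d d'
    have horth := orthonormal_iff_ite.mp hvw d d'
    rw [PiLp.inner_apply] at horth
    simpa [mul_apply, one_apply, mul_comm] using horth
  · ext i d
    fin_cases d
    · simpa [mul_apply, mulVec, dotProduct, mul_comm a] using congrFun (congrArg WithLp.ofLp hv) i
    · simpa [mul_apply, mulVec, dotProduct, mul_comm b, mul_comm c, add_comm]
        using congrFun (congrArg WithLp.ofLp hw) i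

lemma det_transpose_mul_eq_rowMinor_mul (V A : Matrix ι (Fin 2) ℂ) {j k : ι} (hjk : j ≠ k)
    (hA : ∀ l, l ≠ j → l ≠ k → A l = 0) : (Vᵀ * A).det = rowMinor V j k * rowMinor A j k := by
  classical
  have hmul : Vᵀ * A = (V.submatrix ![j, k] id)ᵀ * A.submatrix ![j, k] id := by
    ext d d'
    rw [mul_apply, mul_apply, Fin.sum_univ_two, ← Finset.sum_subset (Finset.subset_univ {j, k}),
      Finset.sum_pair hjk]
    · rfl
    · intro l _ hl
      simp only [Finset.mem_insert, Finset.mem_singleton, not_or] at hl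
      rw [hA l hl.1 hl.2, Pi.zero_apply, mul_zero]
  rw [hmul, det_mul, det_transpose, rowMinor, rowMinor]

lemma norm_transpose_mul_apply_le_one {m : Type*} [DecidableEq m] {V H : Matrix ι m ℂ}
    (hV : Vᴴ * V = 1) (hH : Hᴴ * H = 1) (d d' : m) : ‖(Vᵀ * H) d d'‖ ≤ 1 := by
  have hcs := Finset.sum_mul_sq_le_sq_mul_sq Finset.univ (fun i => ‖V i d‖) fun i => ‖H i d'‖
  rw [sum_norm_sq_col hV, sum_norm_sq_col hH, one_mul, sq_le_one_iff₀ (by positivity)] at hcs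
  exact (norm_sum_le _ _).trans (by simpa only [norm_mul, transpose_apply] using hcs)

lemma norm_det_transpose_mul_le_two {V H : Matrix ι (Fin 2) ℂ} (hV : Vᴴ * V = 1)
    (hH : Hᴴ * H = 1) : ‖(Vᵀ * H).det‖ ≤ 2 := by
  have hentry := norm_transpose_mul_apply_le_one hV hH
  rw [det_fin_two]
  refine (norm_sub_le _ _).trans ?_
  rw [norm_mul, norm_mul]
  linarith [mul_le_one₀ (hentry 0 0) (norm_nonneg _) (hentry 1 1),
    mul_le_one₀ (hentry 0 1) (norm_nonneg _) (hentry 1 0)]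

lemma sum_sum_norm_sq_rowMinor {V : Matrix ι (Fin 2) ℂ} (hV : Vᴴ * V = 1) :
    ∑ k, ∑ j, ‖rowMinor V j k‖ ^ 2 = 2 := by
  have hcross (j k : ι) : rowMinor V j k = crossVec V (V k) j := by
    simp [rowMinor_eq, crossVec, mulVec, dotProduct, Fin.sum_univ_two, sub_eq_add_neg]
  simp_rw [hcross, sum_norm_sq_crossVec hV]
  rw [Finset.sum_comm]
  simp_rw [sum_norm_sq_col hV]
  simp

lemma exists_weights_mul_norm_rowMinor_le [DecidableEq ι] {M : Matrix ι ι ℝ} {a b : ℂ}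
    (h : {a, b} ≤ (M.map (algebraMap ℝ ℂ)).charpoly.roots) (z : ℂ) :
    ∃ W : ι → ι → ℝ, (∀ j k, 0 ≤ W j k) ∧ (∀ j, W j j = 0) ∧ ∑ k, ∑ j, W j k ^ 2 = 2 ∧
      ∀ j k, j ≠ k → ∀ H, IsAnnihilatingFrame (shift M z) j k H →
        W j k * ‖rowMinor (shift M z * H) j k‖ ≤ 2 * (‖a - z‖ * ‖b - z‖) := by
  rw [← charpoly_transpose] at h
  obtain ⟨V, hV, c, hMV⟩ := exists_isometry_mul_eq_triangular h
  refine ⟨fun j k => ‖rowMinor V j k‖, fun _ _ => norm_nonneg _, fun j => ?_,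
    sum_sum_norm_sq_rowMinor hV, fun j k hjk H hH => ?_⟩
  · simp [rowMinor_eq, mul_comm]
  have hshift : Vᵀ * shift M z = !![a - z, c; 0, b - z]ᵀ * Vᵀ := by
    have htri : !![a - z, c; 0, b - z] = !![a, c; 0, b] - z • 1 := by
      ext i l
      fin_cases i <;> fin_cases l <;> simp
    rw [shift, ← transpose_mul, htri, Matrix.mul_sub, Matrix.mul_sub, ← hMV, transpose_sub,
      transpose_mul, transpose_transpose]
    simp
  have hdet : rowMinor V j k * rowMinor (shift M z * H) j k
      = (a - z) * (b - z) * (Vᵀ * H).det := by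
    rw [← det_transpose_mul_eq_rowMinor_mul V _ hjk hH.2, ← Matrix.mul_assoc, hshift,
      Matrix.mul_assoc, det_mul, det_transpose, det_fin_two_of, mul_zero, sub_zero]
  rw [← norm_mul, hdet, norm_mul, norm_mul, mul_comm]
  gcongr
  exact norm_det_transpose_mul_le_two hV hH.1

end TriangularPair

section ClosePair

open Matrix

lemma measure_le_tsum_mul_measure {α β : Type*} [MeasurableSpace α] [Countable β]
    {μ : Measure α} {T : β → Set α} (hT : ∀ i, MeasurableSet (T i)) {w : β → ENNReal} {S : Set α}
    (h : ∀ x ∈ S, 1 ≤ ∑' i, w i * (T i).indicator 1 x) : μ S ≤ ∑' i, w i * μ (T i) := by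
  have hmeas (i : β) : Measurable fun x => w i * (T i).indicator (1 : α → ENNReal) x :=
    (measurable_one.indicator (hT i)).const_mul _
  calc μ S ≤ μ {x | 1 ≤ ∑' i, w i * (T i).indicator 1 x} := measure_mono h
    _ ≤ ∫⁻ x, ∑' i, w i * (T i).indicator 1 x ∂μ := by
      simpa only [one_mul] using mul_meas_ge_le_lintegral (Measurable.tsum hmeas) 1
    _ = ∑' i, w i * μ (T i) := by
      rw [lintegral_tsum fun i => (hmeas i).aemeasurable]
      congr! with i
      rw [lintegral_const_mul _ (measurable_one.indicator (hT i)), lintegral_indicator_one (hT i)]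

lemma ofReal_sq_div_two_le_tsum_indicator {α : Type*} {T : ℕ → Set α} {x : α} {W : ℝ}
    (hW : 0 ≤ W) (hW₂ : W ≤ 2) (hx : ∀ m, 2 * (1 / 4) ^ (m + 1) < W → x ∈ T m) :
    ENNReal.ofReal (W ^ 2 / 2)
      ≤ ∑' m, ENNReal.ofReal (2 * (1 / 16) ^ m) * (T m).indicator 1 x := by
  rcases hW.eq_or_lt with rfl | hW
  · simp
  obtain ⟨m, hlt, hle⟩ := exists_nat_pow_near_of_lt_one (x := W / 2) (y := 1 / 4) (by positivity)
    (by linarith) (by norm_num) (by norm_num)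
  refine le_trans ?_ (ENNReal.le_tsum m)
  rw [Set.indicator_of_mem (hx m (by linarith)), Pi.one_apply, mul_one]
  refine ENNReal.ofReal_le_ofReal ?_
  calc W ^ 2 / 2 = 2 * (W / 2) ^ 2 := by ring
    _ ≤ 2 * ((1 / 4) ^ m) ^ 2 := by gcongr
    _ = 2 * (1 / 16) ^ m := by rw [pow_right_comm]; norm_num

lemma tsum_ofReal_mul_geometric {a r : ℝ} (ha : 0 ≤ a) (hr : 0 ≤ r) (hr₁ : r < 1) :
    ∑' m : ℕ, ENNReal.ofReal (a * r ^ m) = ENNReal.ofReal (a * (1 - r)⁻¹) := by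
  rw [← ENNReal.ofReal_tsum_of_nonneg (fun m => by positivity)
    ((summable_geometric_of_lt_one hr hr₁).mul_left a), tsum_mul_left,
    tsum_geometric_of_lt_one hr hr₁]

variable {n : ℕ}

/-- The matrices of norm at most `R`, given by their rows, that have two eigenvalues `a, b`
(counted with multiplicity) with `|a - z| |b - z| ≤ τ`. -/
def closePairSet (z : ℂ) (R τ : ℝ) : Set (Fin n → Fin n → ℝ) :=
  {x | opNorm (of x) ≤ R ∧ ∃ a b, {a, b} ≤ eigenvalues (of x) ∧ ‖a - z‖ * ‖b - z‖ ≤ τ}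

lemma one_le_tsum_indicator_thinSet {z : ℂ} {R τ : ℝ} (hτ : 0 < τ) {x : Fin n → Fin n → ℝ}
    (hx : x ∈ closePairSet z R τ) :
    1 ≤ ∑' p : Fin n × Fin n × ℕ, (if p.1 = p.2.1 then 0 else ENNReal.ofReal (2 * (1 / 16) ^ p.2.2))
      * (thinSet z R (4 * τ * 4 ^ p.2.2) p.1 p.2.1).indicator 1 x := by
  obtain ⟨hxR, a, b, hab, hτab⟩ := hx
  obtain ⟨W, hW, hW₀, hWsum, hWle⟩ := exists_weights_mul_norm_rowMinor_le hab z
  have hW₂ (j k : Fin n) : W j k ≤ 2 := by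
    have hle : W j k ^ 2 ≤ 2 := hWsum ▸
      (Finset.single_le_sum (f := fun j => W j k ^ 2) (fun _ _ => sq_nonneg _)
        (Finset.mem_univ j)).trans
      (Finset.single_le_sum (f := fun k => ∑ j, W j k ^ 2)
        (fun _ _ => Finset.sum_nonneg fun _ _ => sq_nonneg _) (Finset.mem_univ k))
    nlinarith
  have hmem (j k : Fin n) (hjk : j ≠ k) (m : ℕ) (hm : 2 * (1 / 4) ^ (m + 1) < W j k) :
      x ∈ thinSet z R (4 * τ * 4 ^ m) j k := by
    refine ⟨hxR, fun H hH => ?_⟩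
    by_contra! hlarge
    have hlt : 2 * τ < W j k * ‖rowMinor (shift (of x) z * H) j k‖ :=
      calc 2 * τ = 2 * (1 / 4) ^ (m + 1) * (4 * τ * 4 ^ m) := by
            rw [one_div, inv_pow]
            field_simp
            ring
        _ < W j k * (4 * τ * 4 ^ m) := by gcongr
        _ ≤ _ := by gcongr; exact hW j k
    linarith [hWle j k hjk H hH]
  calc (1 : ENNReal) = ENNReal.ofReal (∑ j, ∑ k, W j k ^ 2 / 2) := by
        simp_rw [← Finset.sum_div]
        rw [Finset.sum_comm, hWsum]
        norm_num
    _ = ∑ j, ∑ k, ENNReal.ofReal (W j k ^ 2 / 2) := by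
        rw [ENNReal.ofReal_sum_of_nonneg fun _ _ => by positivity]
        congr! with j
        exact ENNReal.ofReal_sum_of_nonneg fun _ _ => by positivity
    _ ≤ _ := by
        simp_rw [ENNReal.tsum_prod', tsum_fintype]
        gcongr with j _ k _
        rcases eq_or_ne j k with rfl | hjk
        · simp [hW₀]
        · simp only [hjk, if_false]
          exact ofReal_sq_div_two_le_tsum_indicator (hW j k) (hW₂ j k) (hmem j k hjk)

lemma measure_closePairSet_le {μ : Measure (Fin n → Fin n → ℝ)} {z : ℂ} {R τ : ℝ} (hτ : 0 < τ)
    {b : ℕ → ENNReal} (hb : ∀ m j k, j ≠ k → μ (thinSet z R (4 * τ * 4 ^ m) j k) ≤ b m) :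
    μ (closePairSet z R τ) ≤ n ^ 2 * ∑' m, ENNReal.ofReal (2 * (1 / 16) ^ m) * b m := by
  refine (measure_le_tsum_mul_measure
    (fun p : Fin n × Fin n × ℕ => measurableSet_thinSet z R _ p.1 p.2.1)
    fun x => one_le_tsum_indicator_thinSet hτ).trans ?_
  calc _ ≤ ∑' p : Fin n × Fin n × ℕ, ENNReal.ofReal (2 * (1 / 16) ^ p.2.2) * b p.2.2 := by
        refine ENNReal.tsum_le_tsum fun p => ?_
        split_ifs with hp
        · simp
        · gcongr
          exact hb _ _ _ hp
    _ = _ := by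
        simp_rw [ENNReal.tsum_prod', tsum_fintype, Finset.sum_const, Finset.card_univ,
          Fintype.card_fin, nsmul_eq_mul]
        ring

lemma pi_closePairSet_le {ν : Fin n → Fin n → Measure ℝ} [∀ j i, IsProbabilityMeasure (ν j i)]
    {κ : ℝ} (hκ : 0 < κ) (hν : ∀ j i, ν j i ≤ ENNReal.ofReal κ • volume) {z : ℂ} {R : ℝ}
    (hR : 0 < R) (hre : |z.re| ≤ 2 * R) (him : |z.im| ≤ 2 * R) (hz : 0 < |z.im|) {τ : ℝ}
    (hτ : 0 < τ) :
    Measure.pi (fun j => Measure.pi (ν j)) (closePairSet z R τ)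
      ≤ ENNReal.ofReal
        (16 * n ^ 2 * √((24 * κ ^ 2 * n * τ) ^ 3 * ((10 * R + 1 / (κ * √n)) / |z.im|))) := by
  set c := (10 * R + 1 / (κ * √n)) / |z.im|
  refine (measure_closePairSet_le hτ
    fun m j k hjk => pi_thinSet_le hκ hν hR hre him hz (by positivity) hjk).trans ?_
  have hterm (m : ℕ) : ENNReal.ofReal (2 * (1 / 16) ^ m)
        * ENNReal.ofReal (4 * √((6 * κ ^ 2 * n * (4 * τ * 4 ^ m)) ^ 3 * c))
      = ENNReal.ofReal (8 * √((24 * κ ^ 2 * n * τ) ^ 3 * c) * (1 / 2) ^ m) := by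
    have hroot : (6 * κ ^ 2 * n * (4 * τ * 4 ^ m)) ^ 3 * c
        = (8 ^ m) ^ 2 * ((24 * κ ^ 2 * n * τ) ^ 3 * c) := by
      have hpow : ((4 : ℝ) ^ m) ^ 3 = (8 ^ m) ^ 2 := by
        rw [pow_right_comm, pow_right_comm 8]
        norm_num
      rw [← hpow]
      ring
    rw [hroot, Real.sqrt_mul (by positivity), Real.sqrt_sq (by positivity),
      ← ENNReal.ofReal_mul (by positivity), show (1 / 2 : ℝ) = 1 / 16 * 8 by norm_num,
      mul_pow (1 / 16 : ℝ)]
    congr 1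
    ring
  rw [tsum_congr hterm, tsum_ofReal_mul_geometric (by positivity) (by norm_num) (by norm_num),
    ← ENNReal.ofReal_natCast, ← ENNReal.ofReal_pow (by positivity),
    ← ENNReal.ofReal_mul (by positivity)]
  refine ENNReal.ofReal_le_ofReal (le_of_eq ?_)
  ring

end ClosePair

section Grid

open Matrix WithLp

variable {n : ℕ}

lemma norm_toLp_map_mulVec_le (M : Matrix (Fin n) (Fin n) ℝ) (g : Fin n → ℂ) :
    ‖toLp 2 (M.map (algebraMap ℝ ℂ) *ᵥ g)‖ ≤ opNorm M * ‖toLp 2 g‖ := by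
  have hre (i : Fin n) :
      ((M.map (algebraMap ℝ ℂ) *ᵥ g) i).re = (M *ᵥ fun l => (g l).re) i := by
    simp [mulVec, dotProduct]
  have him (i : Fin n) :
      ((M.map (algebraMap ℝ ℂ) *ᵥ g) i).im = (M *ᵥ fun l => (g l).im) i := by
    simp [mulVec, dotProduct]
  have hM : 0 ≤ opNorm M := norm_nonneg _
  refine le_of_sq_le_sq ?_ (by positivity)
  simp_rw [mul_pow, norm_toLp_sq_eq_re_add_im, hre, him, mul_add, ← mul_pow]
  gcongr <;> exact norm_toLp_mulVec_le M _

lemma norm_le_opNorm_of_mem_eigenvalues {M : Matrix (Fin n) (Fin n) ℝ} {a : ℂ}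
    (ha : a ∈ eigenvalues M) : ‖a‖ ≤ opNorm M := by
  have hchar : (toLpLin 2 2 (M.map (algebraMap ℝ ℂ))).charpoly
      = (M.map (algebraMap ℝ ℂ)).charpoly := by
    rw [toLpLin_eq_toLin, charpoly_toLin]
  rw [eigenvalues, ← hchar] at ha
  obtain ⟨v, hv⟩ := exists_hasEigenvector_of_mem_roots ha
  refine le_of_mul_le_mul_right ?_ (norm_pos_iff.mpr hv.2)
  rw [← norm_smul, ← hv.apply_eq_smul]
  exact norm_toLp_map_mulVec_le M (ofLp v)

lemma exists_int_abs_sub_le {s R t : ℝ} (hs : 0 < s) (ht : |t| ≤ R) :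
    ∃ k ∈ Finset.Ico (-(⌊R / s⌋₊ + 1 : ℤ)) (⌊R / s⌋₊ + 1), |t - (k + 1 / 2) * s| ≤ s / 2 := by
  have hN := Nat.lt_floor_add_one (R / s)
  rw [div_lt_iff₀ hs] at hN
  obtain ⟨hlower, hupper⟩ := abs_le.mp ht
  refine ⟨⌊t / s⌋, Finset.mem_Ico.mpr ⟨Int.le_floor.mpr ?_, Int.floor_lt.mpr ?_⟩, ?_⟩
  · push_cast
    rw [le_div_iff₀ hs]
    linarith
  · push_cast
    rw [div_lt_iff₀ hs]
    linarith
  · have hle := Int.floor_le (t / s)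
    have hlt := Int.lt_floor_add_one (t / s)
    rw [le_div_iff₀ hs] at hle
    rw [div_lt_iff₀ hs] at hlt
    rw [abs_le]
    constructor <;> linarith

lemma one_div_sqrt_add_half_le {x : ℝ} (hx : 0 ≤ x) :
    1 / √(x + 1 / 2) ≤ 2 * (√(x + 1) - √x) := by
  have hconcave : √x + √(x + 1) ≤ 2 * √(x + 1 / 2) := by
    refine le_of_sq_le_sq ?_ (by positivity)
    rw [mul_pow, Real.sq_sqrt (by positivity)]
    linarith [add_sq_le (a := √x) (b := √(x + 1)), Real.sq_sqrt hx,
      Real.sq_sqrt (show 0 ≤ x + 1 by positivity)]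
  have hdiff : (√(x + 1) - √x) * (√x + √(x + 1)) = 1 := by
    ring_nf
    rw [Real.sq_sqrt hx, Real.sq_sqrt (by positivity)]
    ring
  rw [div_le_iff₀ (by positivity)]
  have hmono : 0 ≤ √(x + 1) - √x := sub_nonneg.mpr (Real.sqrt_le_sqrt (by linarith))
  linarith [mul_le_mul_of_nonneg_left hconcave hmono]

lemma sum_Ico_one_div_sqrt_abs_le (N : ℕ) :
    ∑ m ∈ Finset.Ico (-N : ℤ) N, 1 / √|(m : ℝ) + 1 / 2| ≤ 4 * √N := by
  induction N with
  | zero => simp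
  | succ N ih =>
    have hIco : Finset.Ico (-(N + 1 : ℕ) : ℤ) (N + 1 : ℕ)
        = insert (-(N + 1 : ℤ)) (insert (N : ℤ) (Finset.Ico (-N : ℤ) N)) := by
      ext m
      simp only [Finset.mem_Ico, Finset.mem_insert]
      omega
    rw [hIco, Finset.sum_insert, Finset.sum_insert (by simp)]
    · have hneg : |((-(N + 1 : ℤ) : ℤ) : ℝ) + 1 / 2| = N + 1 / 2 := by
        push_cast
        rw [← abs_neg, abs_of_nonneg] <;> linarith [N.cast_nonneg (α := ℝ)]
      have hpos : |((N : ℤ) : ℝ) + 1 / 2| = N + 1 / 2 := abs_of_pos (by positivity)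
      rw [hneg, hpos, Nat.cast_add_one]
      linarith [one_div_sqrt_add_half_le (N.cast_nonneg (α := ℝ))]
    · simp only [Finset.mem_insert, Finset.mem_Ico]
      omega

/-- The centre of the cell with integer indices `k, m` of the square grid of mesh `s`. The centres
stay away from the real axis, where the bound on `closePairSet` degenerates. -/
def gridPoint (s : ℝ) (k m : ℤ) : ℂ := ⟨(k + 1 / 2) * s, (m + 1 / 2) * s⟩

/-- The matrices of norm at most `R`, given by their rows, that have two eigenvalues (counted with
multiplicity) at distance at most `s`. -/
def gapSet (R s : ℝ) : Set (Fin n → Fin n → ℝ) :=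
  {x | opNorm (of x) ≤ R ∧ ∃ a b, {a, b} ≤ eigenvalues (of x) ∧ ‖a - b‖ ≤ s}

lemma gapSet_subset_iUnion_closePairSet {R s : ℝ} (hs : 0 < s) :
    gapSet (n := n) R (2 * s) ⊆ ⋃ k ∈ Finset.Ico (-(⌊R / s⌋₊ + 1 : ℤ)) (⌊R / s⌋₊ + 1),
      ⋃ m ∈ Finset.Ico (-(⌊R / s⌋₊ + 1 : ℤ)) (⌊R / s⌋₊ + 1),
        closePairSet (gridPoint s k m) R (3 * s ^ 2) := by
  rintro x ⟨hx, a, b, hab, hdist⟩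
  have ha : ‖a‖ ≤ R :=
    (norm_le_opNorm_of_mem_eigenvalues (Multiset.mem_of_le hab (by simp))).trans hx
  obtain ⟨k, hk, hre⟩ := exists_int_abs_sub_le hs ((Complex.abs_re_le_norm a).trans ha)
  obtain ⟨m, hm, him⟩ := exists_int_abs_sub_le hs ((Complex.abs_im_le_norm a).trans ha)
  have haz : ‖a - gridPoint s k m‖ ≤ s :=
    (Complex.norm_le_abs_re_add_abs_im _).trans ((add_le_add hre him).trans_eq (by ring))
  have hbz : ‖b - gridPoint s k m‖ ≤ 3 * s := by
    rw [norm_sub_rev a b] at hdist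
    linarith [norm_sub_le_norm_sub_add_norm_sub b a (gridPoint s k m)]
  simp only [Set.mem_iUnion]
  refine ⟨k, hk, m, hm, hx, a, b, hab, ?_⟩
  calc _ ≤ s * (3 * s) := by gcongr
    _ = 3 * s ^ 2 := by ring

lemma exists_lt_of_gap_lt {M : Matrix (Fin n) (Fin n) ℝ} {r : ENNReal} (h : gap M < r) :
    ∃ a b, {a, b} ≤ eigenvalues M ∧ ‖a - b‖ₑ < r := by
  simpa only [gap, iInf_lt_iff, exists_prop] using h

lemma setOf_gap_le_subset_gapSet {R s : ℝ} (hs : 0 < s) :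
    {x : Fin n → Fin n → ℝ | opNorm (of x) ≤ R ∧ gap (of x) ≤ ENNReal.ofReal s}
      ⊆ gapSet R (2 * min s R) := by
  rintro x ⟨hx, hgap⟩
  obtain ⟨a, b, hab, hlt⟩ := exists_lt_of_gap_lt (r := ENNReal.ofReal (2 * s))
    (hgap.trans_lt ((ENNReal.ofReal_lt_ofReal_iff (by linarith)).mpr (by linarith)))
  rw [← ofReal_norm, ENNReal.ofReal_lt_ofReal_iff (by linarith)] at hlt
  refine ⟨hx, a, b, hab, ?_⟩
  rw [mul_min_of_nonneg _ _ zero_le_two]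
  refine le_min hlt.le ((norm_sub_le a b).trans ?_)
  rw [two_mul]
  exact add_le_add ((norm_le_opNorm_of_mem_eigenvalues (Multiset.mem_of_le hab (by simp))).trans hx)
    ((norm_le_opNorm_of_mem_eigenvalues (Multiset.mem_of_le hab (by simp))).trans hx)

end Grid

section ProductMeasure

variable {n : ℕ} {ν : Fin n → Fin n → Measure ℝ} [∀ j i, IsProbabilityMeasure (ν j i)] {κ : ℝ}

lemma abs_add_half_mul_le {s R : ℝ} (hs : 0 < s) (hsR : s ≤ R) {k : ℤ}
    (hk : k ∈ Finset.Ico (-(⌊R / s⌋₊ + 1 : ℤ)) (⌊R / s⌋₊ + 1)) :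
    |((k : ℝ) + 1 / 2) * s| ≤ 2 * R := by
  have hfloor := Nat.floor_le (show 0 ≤ R / s by bound)
  rw [le_div_iff₀ hs] at hfloor
  rw [Finset.mem_Ico, ← Int.le_sub_one_iff] at hk
  have hlower : -(⌊R / s⌋₊ + 1 : ℝ) ≤ k := by exact_mod_cast hk.1
  have hupper : (k : ℝ) ≤ ⌊R / s⌋₊ + 1 - 1 := by exact_mod_cast hk.2
  rw [abs_le]
  constructor <;> nlinarith

lemma pi_closePairSet_gridPoint_le (hκ : 0 < κ) (hν : ∀ j i, ν j i ≤ ENNReal.ofReal κ • volume)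
    {s R : ℝ} (hs : 0 < s) (hsR : s ≤ R) {k m : ℤ}
    (hk : k ∈ Finset.Ico (-(⌊R / s⌋₊ + 1 : ℤ)) (⌊R / s⌋₊ + 1))
    (hm : m ∈ Finset.Ico (-(⌊R / s⌋₊ + 1 : ℤ)) (⌊R / s⌋₊ + 1)) :
    Measure.pi (fun j => Measure.pi (ν j)) (closePairSet (gridPoint s k m) R (3 * s ^ 2))
      ≤ ENNReal.ofReal (16 * n ^ 2 * s ^ 2
          * √((72 * κ ^ 2 * n) ^ 3 * (10 * R + 1 / (κ * √n)) * s) * (1 / √|(m : ℝ) + 1 / 2|)) := by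
  have hR : 0 < R := hs.trans_le hsR
  have hhalf : (m : ℝ) + 1 / 2 ≠ 0 := by
    intro h
    have hodd : (2 * m + 1 : ℝ) = 0 := by linarith
    norm_cast at hodd
    omega
  have him : |(gridPoint s k m).im| = |(m : ℝ) + 1 / 2| * s := by
    rw [gridPoint, abs_mul, abs_of_pos hs]
  refine (pi_closePairSet_le hκ hν hR (abs_add_half_mul_le hs hsR hk)
    (abs_add_half_mul_le hs hsR hm) (by rw [him]; positivity) (by positivity)).trans
    (ENNReal.ofReal_le_ofReal (le_of_eq ?_))
  have hroot : (24 * κ ^ 2 * n * (3 * s ^ 2)) ^ 3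
        * ((10 * R + 1 / (κ * √n)) / (|(m : ℝ) + 1 / 2| * s))
      = (s ^ 2) ^ 2 * ((72 * κ ^ 2 * n) ^ 3 * (10 * R + 1 / (κ * √n)) * s)
        / |(m : ℝ) + 1 / 2| := by
    field_simp
    ring
  rw [him, hroot, Real.sqrt_div (by positivity), Real.sqrt_mul (by positivity),
    Real.sqrt_sq (by positivity)]
  ring

lemma pi_gapSet_le (hκ : 0 < κ) (hν : ∀ j i, ν j i ≤ ENNReal.ofReal κ • volume) {s R : ℝ}
    (hs : 0 < s) (hsR : s ≤ R) :
    Measure.pi (fun j => Measure.pi (ν j)) (gapSet R (2 * s)) ≤ ENNReal.ofReal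
      (256 * R * n ^ 2 * √((72 * κ ^ 2 * n) ^ 3 * (10 * R + 1 / (κ * √n)) * (2 * R)) * s) := by
  set N := ⌊R / s⌋₊ + 1 with hN
  set c := (72 * κ ^ 2 * n) ^ 3 * (10 * R + 1 / (κ * √n))
  have hR : 0 < R := hs.trans_le hsR
  have : 0 ≤ c := by positivity
  have hNR : N * s ≤ 2 * R := by
    have hfloor := Nat.floor_le (show 0 ≤ R / s by positivity)
    rw [le_div_iff₀ hs] at hfloor
    rw [hN]
    push_cast
    linarith
  calc _ ≤ ∑ _k ∈ Finset.Ico (-N : ℤ) N, ∑ m ∈ Finset.Ico (-N : ℤ) N,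
          ENNReal.ofReal (16 * n ^ 2 * s ^ 2 * √(c * s) * (1 / √|(m : ℝ) + 1 / 2|)) := by
        refine (measure_mono (gapSet_subset_iUnion_closePairSet hs)).trans ?_
        rw [hN, Nat.cast_add_one]
        exact (measure_biUnion_finset_le _ _).trans (Finset.sum_le_sum fun k hk =>
          (measure_biUnion_finset_le _ _).trans (Finset.sum_le_sum fun m hm =>
            pi_closePairSet_gridPoint_le hκ hν hs hsR hk hm))
    _ = ENNReal.ofReal (2 * N * (16 * n ^ 2 * s ^ 2 * √(c * s)
          * ∑ m ∈ Finset.Ico (-N : ℤ) N, 1 / √|(m : ℝ) + 1 / 2|)) := by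
        rw [← ENNReal.ofReal_sum_of_nonneg fun _ _ => by positivity, Finset.sum_const, Int.card_Ico,
          ← ENNReal.ofReal_nsmul, ← Finset.mul_sum, nsmul_eq_mul]
        congr 3
        norm_cast
        omega
    _ ≤ ENNReal.ofReal (2 * N * (16 * n ^ 2 * s ^ 2 * √(c * s) * (4 * √N))) := by
        gcongr
        exact sum_Ico_one_div_sqrt_abs_le N
    _ = ENNReal.ofReal (128 * (N * s) * n ^ 2 * √(c * (N * s)) * s) := by
        rw [← mul_assoc c, mul_right_comm c, Real.sqrt_mul (by positivity) (N : ℝ)]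
        congr 1
        ring
    _ ≤ ENNReal.ofReal (128 * (2 * R) * n ^ 2 * √(c * (2 * R)) * s) := by gcongr
    _ = _ := by congr 1; ring

lemma sqrt_mul_pow_three_mul_le {μ R : ℝ} (hμ : 0 ≤ μ) (hR : 0 < R) :
    √((72 * μ ^ 2) ^ 3 * (10 * R + 1 / μ) * (2 * R)) ≤ 2733 * μ ^ 2 * (1 + μ * R) := by
  rcases hμ.eq_or_lt with rfl | hμ
  · simp
  refine Real.sqrt_le_iff.mpr ⟨by positivity, ?_⟩
  calc (72 * μ ^ 2) ^ 3 * (10 * R + 1 / μ) * (2 * R)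
      = 72 ^ 3 * 2 * μ ^ 4 * (10 * (μ * R) ^ 2 + μ * R) := by field_simp
    _ ≤ 72 ^ 3 * 2 * μ ^ 4 * (10 * (1 + μ * R) ^ 2) := by
        gcongr
        linarith [mul_pos hμ hR]
    _ = 72 ^ 3 * 20 * (μ ^ 4 * (1 + μ * R) ^ 2) := by ring
    _ ≤ 2733 ^ 2 * (μ ^ 4 * (1 + μ * R) ^ 2) := by
        gcongr
        norm_num
    _ = _ := by ring

lemma pi_setOf_gap_le_le (hκ : 0 < κ) (hν : ∀ j i, ν j i ≤ ENNReal.ofReal κ • volume) {s R : ℝ}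
    (hs : 0 < s) (hR : 0 < R) :
    Measure.pi (fun j => Measure.pi (ν j))
        {x | opNorm (Matrix.of x) ≤ R ∧ gap (Matrix.of x) ≤ ENNReal.ofReal s}
      ≤ ENNReal.ofReal (10 ^ 6 * κ ^ 2 * n ^ 3 * R * (1 + κ * √n * R) * s) := by
  refine (measure_mono (setOf_gap_le_subset_gapSet hs)).trans
    ((pi_gapSet_le hκ hν (lt_min hs hR) (min_le_right s R)).trans (ENNReal.ofReal_le_ofReal ?_))
  have hsq : (κ * √n) ^ 2 = κ ^ 2 * n := by rw [mul_pow, Real.sq_sqrt (by positivity)]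
  have hroot := sqrt_mul_pow_three_mul_le (μ := κ * √n) (by positivity) hR
  rw [hsq, ← mul_assoc 72] at hroot
  calc _ ≤ 256 * R * n ^ 2 * (2733 * (κ ^ 2 * n) * (1 + κ * √n * R)) * s := by
        gcongr
        exact min_le_left s R
    _ = 699648 * (κ ^ 2 * n ^ 3 * R * (1 + κ * √n * R) * s) := by ring
    _ ≤ 10 ^ 6 * (κ ^ 2 * n ^ 3 * R * (1 + κ * √n * R) * s) := by
        gcongr
        norm_num
    _ = _ := by ring

end ProductMeasure

section RandomMatrix

lemma opNorm_add_smul_le {n : ℕ} (A G : Matrix (Fin n) (Fin n) ℝ) {δ : ℝ} (hδ : 0 ≤ δ) :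
    opNorm (A + δ • G) ≤ opNorm A + δ * opNorm G := by
  rw [opNorm, map_add, map_smul]
  exact (norm_add_le _ _).trans_eq (by rw [norm_smul, Real.norm_of_nonneg hδ, opNorm, opNorm])

lemma map_add_mul_le {ν : Measure ℝ} {κ : ℝ} (hκ : 0 ≤ κ) (hν : ν ≤ ENNReal.ofReal κ • volume)
    (a : ℝ) {d : ℝ} (hd : 0 < d) :
    ν.map (fun u => a + d * u) ≤ ENNReal.ofReal (κ / d) • volume := by
  have hvol : (volume : Measure ℝ).map (fun u => a + d * u) = ENNReal.ofReal d⁻¹ • volume := by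
    rw [← Function.comp_def (a + ·), ← Measure.map_map (by fun_prop) (by fun_prop),
      Real.map_volume_mul_left hd.ne', Measure.map_smul, map_add_left_eq_self,
      abs_of_pos (inv_pos.mpr hd)]
  calc ν.map (fun u => a + d * u) ≤ (ENNReal.ofReal κ • volume).map fun u => a + d * u :=
        Measure.map_mono hν (by fun_prop)
    _ = _ := by
        rw [Measure.map_smul, hvol, smul_smul, ← ENNReal.ofReal_mul hκ, div_eq_mul_inv]

section Density

variable {Ω Ω' : Type*} [MeasurableSpace Ω] [MeasurableSpace Ω'] {P : Measure Ω} {P' : Measure Ω'}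
  {X : Ω → ℝ} {ξ : Ω' → ℝ} {K : ℝ}

lemma HasDensityBoundedBy.map_le (h : HasDensityBoundedBy X P K) :
    P.map X ≤ ENNReal.ofReal K • volume := by
  have := h.1
  rw [map_eq_withDensity_pdf X P volume, ← withDensity_const]
  exact withDensity_mono h.2

lemma HasDensityBoundedBy.aemeasurable (h : HasDensityBoundedBy X P K) : AEMeasurable X P :=
  (hasPDF_iff.mp h.1).1

lemma HasDensityBoundedBy.pos [IsProbabilityMeasure P] (h : HasDensityBoundedBy X P K) :
    0 < K := by
  by_contra! hK
  have hprob := Measure.isProbabilityMeasure_map h.aemeasurable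
  have hle := h.map_le Set.univ
  rw [ENNReal.ofReal_of_nonpos hK, zero_smul, measure_univ] at hle
  simp at hle

lemma HasDensityBoundedBy.of_identDistrib (h : HasDensityBoundedBy ξ P' K)
    (hX : IdentDistrib X ξ P P') : HasDensityBoundedBy X P K := by
  rw [HasDensityBoundedBy, hasPDF_iff, pdf_def, hX.map_eq]
  exact ⟨⟨hX.aemeasurable_fst, (hasPDF_iff.mp h.1).2⟩, h.2⟩

end Density

variable {Ω : Type*} [MeasurableSpace Ω] {P : Measure Ω} [IsProbabilityMeasure P]

lemma map_curry_eq_pi_pi {ι κ : Type*} [Fintype ι] [Fintype κ] {Y : ι × κ → Ω → ℝ}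
    (hY : iIndepFun Y P) (hmeas : ∀ p, AEMeasurable (Y p) P) :
    P.map (fun ω i j => Y (i, j) ω)
      = Measure.pi fun i => Measure.pi fun j => P.map (Y (i, j)) := by
  have (p : ι × κ) : IsProbabilityMeasure (P.map (Y p)) :=
    Measure.isProbabilityMeasure_map (hmeas p)
  have hcurry := Measure.infinitePi_map_curry fun i j => P.map (Y (i, j))
  simp_rw [Measure.infinitePi_eq_pi] at hcurry
  rw [← hcurry, ← (iIndepFun_iff_map_fun_eq_pi_map hmeas).mp hY,
    AEMeasurable.map_map_of_aemeasurable (MeasurableEquiv.measurable _).aemeasurable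
      (aemeasurable_pi_lambda _ hmeas)]
  rfl

lemma measure_opNorm_le_gap_le {n : ℕ} {M : Ω → Matrix (Fin n) (Fin n) ℝ}
    (hM : iIndepFun (fun (p : Fin n × Fin n) ω => M ω p.1 p.2) P)
    (hmeas : ∀ i j, AEMeasurable (fun ω => M ω i j) P) {κ : ℝ} (hκ : 0 < κ)
    (hle : ∀ i j, P.map (fun ω => M ω i j) ≤ ENNReal.ofReal κ • volume) {s R : ℝ} (hs : 0 < s)
    (hR : 0 < R) :
    P {ω | opNorm (M ω) ≤ R ∧ gap (M ω) ≤ ENNReal.ofReal s}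
      ≤ ENNReal.ofReal (10 ^ 6 * κ ^ 2 * n ^ 3 * R * (1 + κ * √n * R) * s) := by
  have (i j : Fin n) : IsProbabilityMeasure (P.map fun ω => M ω i j) :=
    Measure.isProbabilityMeasure_map (hmeas i j)
  have hlaw := map_curry_eq_pi_pi hM fun p => hmeas p.1 p.2
  refine le_trans ?_ (pi_setOf_gap_le_le hκ hle hs hR)
  rw [← hlaw]
  exact Measure.le_map_apply
    (aemeasurable_pi_lambda _ fun i => aemeasurable_pi_lambda _ (hmeas i)) _

end RandomMatrix

section ScaledMatrix

lemma gap_fin_zero (M : Matrix (Fin 0) (Fin 0) ℝ) : gap M = ⊤ := by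
  simp [gap, eigenvalues]

lemma one_le_logb_two_mul_div {R s : ℝ} (hs : 0 < s) (hsR : s ≤ R) :
    1 ≤ Real.logb 2 (2 * R / s) := by
  rw [Real.le_logb_iff_rpow_le one_lt_two (by have := hs.trans_le hsR; positivity), Real.rpow_one,
    le_div_iff₀ hs]
  gcongr

lemma gap_bound_le_max {n K δ R s : ℝ} (hn : 1 ≤ n) (hK : 0 ≤ K) (hδ : 0 < δ) (hδ1 : δ ≤ 1)
    (hR : 1 ≤ R) (hs : 0 ≤ s) :
    10 ^ 6 * (K / (δ / √n)) ^ 2 * n ^ 3 * R * (1 + K / (δ / √n) * √n * R) * s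
      ≤ 2 * 10 ^ 6 * R ^ 2 * max (K ^ 2) (K ^ 3) * n ^ 5 * (s / δ ^ 3) := by
  have hsq : √n ^ 2 = n := Real.sq_sqrt (by positivity)
  have hκ_sq : (K / (δ / √n)) ^ 2 = K ^ 2 * n / δ ^ 2 := by
    rw [div_div_eq_mul_div, div_pow, mul_pow, hsq]
  have hκ_mul : K / (δ / √n) * √n = K * n / δ := by
    rw [div_div_eq_mul_div, div_mul_eq_mul_div, mul_assoc, ← sq, hsq]
  have hδn : δ ≤ n * R := hδ1.trans (one_le_mul_of_one_le_of_one_le hn hR)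
  calc _ = 10 ^ 6 * (K ^ 2 * δ + K ^ 3 * (n * R)) * (n ^ 4 * R * s / δ ^ 3) := by
        rw [hκ_sq, hκ_mul]; field_simp
    _ ≤ 10 ^ 6 * (max (K ^ 2) (K ^ 3) * (n * R) + max (K ^ 2) (K ^ 3) * (n * R))
          * (n ^ 4 * R * s / δ ^ 3) := by
        gcongr
        exacts [le_max_left _ _, le_max_right _ _]
    _ = _ := by ring

variable {Ω : Type*} [MeasurableSpace Ω] {P : Measure Ω} [IsProbabilityMeasure P]

lemma measure_opNorm_le_gap_add_smul_le {n : ℕ} (hn : 0 < n) (A : Matrix (Fin n) (Fin n) ℝ)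
    {G : Ω → Matrix (Fin n) (Fin n) ℝ} {K δ R s : ℝ}
    (hG : iIndepFun (fun (p : Fin n × Fin n) ω => √(n : ℝ) * G ω p.1 p.2) P)
    (hdens : ∀ i j, HasDensityBoundedBy (fun ω => √(n : ℝ) * G ω i j) P K) (hK : 0 < K)
    (hδ : 0 < δ) (hR : 0 < R) (hs : 0 < s) :
    P {ω | opNorm (A + δ • G ω) ≤ R ∧ gap (A + δ • G ω) ≤ ENNReal.ofReal s}
      ≤ ENNReal.ofReal (10 ^ 6 * (K / (δ / √n)) ^ 2 * n ^ 3 * R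
          * (1 + K / (δ / √n) * √n * R) * s) := by
  have : 0 < √(n : ℝ) := by positivity
  have hentry (i j : Fin n) : (fun ω => (A + δ • G ω) i j)
      = (fun u => A i j + δ / √n * u) ∘ fun ω => √(n : ℝ) * G ω i j := by
    ext ω
    simp only [Matrix.add_apply, Matrix.smul_apply, smul_eq_mul, Function.comp_apply]
    field_simp
  have hmeas (i j : Fin n) : AEMeasurable (fun ω => (A + δ • G ω) i j) P := by
    rw [hentry]
    exact Measurable.comp_aemeasurable (by fun_prop) (hdens i j).aemeasurable
  have hindep : iIndepFun (fun (p : Fin n × Fin n) ω => (A + δ • G ω) p.1 p.2) P := by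
    rw [funext fun p : Fin n × Fin n => hentry p.1 p.2]
    exact hG.comp (fun p u => A p.1 p.2 + δ / √n * u) fun p => by fun_prop
  refine measure_opNorm_le_gap_le hindep hmeas (by positivity) (fun i j => ?_) hs hR
  rw [hentry, ← AEMeasurable.map_map_of_aemeasurable (by fun_prop) (hdens i j).aemeasurable]
  exact map_add_mul_le hK.le (hdens i j).map_le _ (by positivity)

end ScaledMatrix

end EigenvalueGap

end

theorem mainTheorem3_general :
    ∃ c : ℝ, 0 < c ∧
      ∀ {Ω : Type*} [MeasurableSpace Ω] (P : Measure Ω) [IsProbabilityMeasure P] (K : ℝ) (n : ℕ)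
        (G : Ω → Matrix (Fin n) (Fin n) ℝ)
        (_ : iIndepFun (fun (p : Fin n × Fin n) ω => √(n : ℝ) * G ω p.1 p.2) P)
        (_ : ∀ i j, EigenvalueGap.HasDensityBoundedBy (fun ω => √(n : ℝ) * G ω i j) P K)
        (A : Matrix (Fin n) (Fin n) ℝ) (_ : EigenvalueGap.opNorm A ≤ 1)
        (δ : ℝ) (_ : 0 < δ) (_ : δ ≤ 1) (K' : ℝ) (_ : 0 ≤ K') (s : ℝ) (_ : 0 < s),
        P.real {ω | EigenvalueGap.opNorm (G ω) ≤ K' ∧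
            EigenvalueGap.gap (A + δ • G ω) ≤ ENNReal.ofReal s} ≤
          c * (1 + δ * K') ^ 2 * max (K ^ 2) (K ^ 3) * (n : ℝ) ^ 5 * (s / δ ^ 3) := by
  refine ⟨2 * 10 ^ 6, by positivity, ?_⟩
  intro Ω _ P _ K n G hG hdens A hA δ hδ hδ1 K' hK' s hs
  rcases n.eq_zero_or_pos with rfl | hn
  · simp [EigenvalueGap.gap_fin_zero]
  have hK : 0 < K := (hdens ⟨0, hn⟩ ⟨0, hn⟩).pos
  have hR : 1 ≤ 1 + δ * K' := le_add_of_nonneg_right (by positivity)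
  have hM (ω : Ω) (hω : EigenvalueGap.opNorm (G ω) ≤ K') :
      EigenvalueGap.opNorm (A + δ • G ω) ≤ 1 + δ * K' := by
    grw [EigenvalueGap.opNorm_add_smul_le A (G ω) hδ.le, hA, hω]
  have : 0 ≤ max (K ^ 2) (K ^ 3) := le_max_of_le_left (sq_nonneg K)
  refine ENNReal.toReal_le_of_le_ofReal (by positivity) ?_
  calc P {ω | EigenvalueGap.opNorm (G ω) ≤ K' ∧
          EigenvalueGap.gap (A + δ • G ω) ≤ ENNReal.ofReal s}
      ≤ P {ω | EigenvalueGap.opNorm (A + δ • G ω) ≤ 1 + δ * K' ∧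
          EigenvalueGap.gap (A + δ • G ω) ≤ ENNReal.ofReal s} :=
        measure_mono fun ω hω => ⟨hM ω hω.1, hω.2⟩
    _ ≤ _ := EigenvalueGap.measure_opNorm_le_gap_add_smul_le hn A hG hdens hK hδ (by positivity) hs
    _ ≤ _ := ENNReal.ofReal_le_ofReal
        (EigenvalueGap.gap_bound_le_max (Nat.one_le_cast.mpr hn) hK.le hδ hδ1
          hR hs.le)

theorem mainTheorem3 :
    ∃ c : ℝ, 0 < c ∧
      ∀ {Ω Ω' : Type*} [MeasurableSpace Ω] [MeasurableSpace Ω']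
        (P : Measure Ω) [IsProbabilityMeasure P] (P' : Measure Ω') [IsProbabilityMeasure P']
        (ξ : Ω' → ℝ) (K : ℝ)
        (_ : EigenvalueGap.IsSubGaussian ξ P') (_ : EigenvalueGap.HasDensityBoundedBy ξ P' K)
        (n : ℕ) (G : Ω → Matrix (Fin n) (Fin n) ℝ)
        (_ : EigenvalueGap.IsScaledIIDMatrix G P ξ P')
        (A : Matrix (Fin n) (Fin n) ℝ) (_ : EigenvalueGap.opNorm A ≤ 1)
        (δ : ℝ) (_ : 0 < δ) (_ : δ < 1) (K' : ℝ) (_ : 0 ≤ K') (s : ℝ) (_ : 0 < s) (_ : s ≤ 1),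
        P.real {ω | EigenvalueGap.opNorm (G ω) ≤ K' ∧
            EigenvalueGap.gap (A + δ • G ω) ≤ ENNReal.ofReal s} ≤
          c * Real.logb 2 (2 * (1 + δ * K') / s) * (1 + δ * K') ^ 2 * max (K ^ 2) (K ^ 3) *
            (n : ℝ) ^ 5 * (s / δ ^ 3) := by
  obtain ⟨c, hc, hbound⟩ := mainTheorem3_general
  refine ⟨c, hc, ?_⟩
  intro Ω Ω' _ _ P _ P' _ ξ K _ hξ n G hG A hA δ hδ hδ1 K' hK' s hs hs1
  refine (hbound P K n G hG.1 (fun i j => hξ.of_identDistrib (hG.2 i j)) A hA δ hδ hδ1.le K' hK'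
    s hs).trans ?_
  have hlog : 1 ≤ Real.logb 2 (2 * (1 + δ * K') / s) :=
    EigenvalueGap.one_le_logb_two_mul_div hs (hs1.trans (le_add_of_nonneg_right (by positivity)))
  have : 0 ≤ max (K ^ 2) (K ^ 3) := le_max_of_le_left (sq_nonneg K)
  gcongr
  exact le_mul_of_one_le_right hc.le hlog
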